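/- There is an absolute constant $c_0>0$ with the following property. Let $\epsilon_0\in(0,1)$, let $(p_n)$ be a sequence in $[0,1]$ with $n^{\epsilon_0-1}\le p_n\le \tfrac12$ for all sufficiently large $n$, and let $(m_n)$ be a sequence of natural numbers with $$\frac{1}{c_0\epsilon_0}\le m_n\le \frac{c_0\epsilon_0\log n}{\log\log n}$$ for all sufficiently large $n$. For each $n$ let $A=A_n=(a_{ij})_{1\le i,j\le n}$ be a random real symmetric matrix (the matrices for different $n$ may live on different probability spaces) whose entries $(a_{ij})_{1\le i\le j\le n}$ on and above the diagonal are independent with $\mathbb P(a_{ij}=1)=p_n$ and $\mathbb P(a_{ij}=0)=1-p_n$. Then, writing $m=m_n$, $$\frac{\operatorname{tr}(A^{2m})-\mathbb E[\operatorname{tr}(A^{2m})]}{2m\,(np_n)^{2m-1}\sqrt{p_n(1-p_n)}}\;\Longrightarrow\;N(0,2)\qquad (n\to\infty)$$ in distribution, where $N(0,2)$ is the centered normal law with variance $2$. -/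

import Mathlib

open MeasureTheory ProbabilityTheory Filter Topology

/-- `A` is a random real symmetric `n × n` matrix on the probability space `(Ω, P)` whose entries
on and above the diagonal are independent Bernoulli variables, equal to `1` with probability `p`
and to `0` with probability `1 - p`. -/
structure IsSymmBernoulliMatrix {Ω : Type*} [MeasurableSpace Ω] (P : Measure Ω) {n : ℕ}
    (p : unitInterval) (A : Ω → Matrix (Fin n) (Fin n) ℝ) : Prop where
  isSymm : ∀ ω, (A ω).IsSymm
  hasLaw : ∀ i j : Fin n, i ≤ j → HasLaw (fun ω ↦ A ω i j) (bernoulliMeasure (1 : ℝ) 0 p) P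
  iIndepFun : iIndepFun (fun (e : {e : Fin n × Fin n // e.1 ≤ e.2}) ω ↦ A ω e.1.1 e.1.2) P

/-- The centered trace `tr (A ^ (2m)) - E tr (A ^ (2m))` of a random `n × n` matrix, divided by
`2m (np)^(2m-1) √(p(1-p))`. -/
noncomputable def normalizedTrace {Ω : Type*} [MeasurableSpace Ω] (P : Measure Ω) {n : ℕ}
    (p : ℝ) (m : ℕ) (A : Ω → Matrix (Fin n) (Fin n) ℝ) (ω : Ω) : ℝ :=
  (((A ω) ^ (2 * m)).trace - ∫ ω', ((A ω') ^ (2 * m)).trace ∂P) /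
    (2 * (m : ℝ) * ((n : ℝ) * p) ^ (2 * m - 1) * √(p * (1 - p)))

/-! The trace is dominated by its linear part in the entries. Put N = 2m. As the entries `ξ e` are 0
or 1, tr(A^N) is almost surely F = ∑ over closed walks w of the square-free monomial ∏ `ξ e` over
the set E(w) of distinct edges. A given edge lies on about 2N n^(N-2) walks, each having its other
N-1 edges present with probability p^(N-1). So F should fluctuate like cL, where L = ∑ `ξ e` and c =
2N(np)^(N-1)/n. After centering and normalization, cL is a sum of independent variables of total
variance 2(1 + 1/n), and its characteristic function tends to that of N(0,2).

It remains to show that Var(F - cL) = Var F - 2c Cov(F, L) + c² Var L is small. In units of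
(N(np)^(N-1))² p(1-p), the three terms are at most 2 + error, at most -4, and 2 + 2/n, so the main
parts cancel; one-sided bounds are enough. The bound on Cov(F, L) is that j p^j decreases in j ≥ 1
for p ≤ 1/2 (`mul_pow_antitone`): a walk with repeated edges contributes at least as much as one
with N distinct edges.

For Var F, only pairs of walks sharing an edge count, with weight |E ∩ E'| p^|E ∪ E'|. Pairs sharing
one edge, with 2N-1 edges in the union, give the 2. The others are controlled by graph theory
(`card_pairVerts_add_one_le_or`). If the union has v vertices, then either it has at least v+1
edges, and v ≤ 2N-3 gives a relative error of order (2N)^6/(np); or about N/4 of the 2N positions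
are coincidences. Such pairs are rarer by the factor ((2N)²/(np))^(N/4)
(`sum_pow_card_image_of_coincidences_le`), a large negative power of n because ε₀m is large. -/

/-- A vertex set reachable from `r` through the edges in `E` has at most `#E + 1` elements. -/
lemma card_le_card_edges_add_one {V : Type*} [DecidableEq V] [Fintype V]
    (E : Finset (Sym2 V)) (S : Finset V) (r : V)
    (h : ∀ T : Finset V, r ∈ T → (∀ a b, s(a, b) ∈ E → a ∈ T → b ∈ T) → S ⊆ T) :
    S.card ≤ E.card + 1 := by
  -- Grow a tree from the root. `T` is the set reached so far, and `F` contains an edge for each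
  -- vertex added; the induction is on the number of vertices outside `T`.
  suffices H : ∀ k : ℕ, ∀ T : Finset V, ∀ F ⊆ E, Fintype.card V - T.card = k → r ∈ T →
      (∀ x ∈ F, ∀ a ∈ x, a ∈ T) → T.card ≤ F.card + 1 → S.card ≤ E.card + 1 from
    H _ {r} ∅ (by simp) rfl (by simp) (by simp) (by simp)
  intro k
  induction k using Nat.strong_induction_on with
  | _ k ih =>
    intro T F hF hk hr hFT hT
    by_cases hcl : ∀ a b, s(a, b) ∈ E → a ∈ T → b ∈ T
    · exact (Finset.card_le_card (h T hr hcl)).trans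
        (hT.trans (Nat.add_le_add_right (Finset.card_le_card hF) 1))
    · push Not at hcl
      obtain ⟨a, b, hab, ha, hb⟩ := hcl
      have hbF : s(a, b) ∉ F := fun hmem ↦ hb (hFT _ hmem b (by simp))
      have hle : (insert b T).card ≤ Fintype.card V := Finset.card_le_univ _
      rw [Finset.card_insert_of_notMem hb] at hle
      refine ih (Fintype.card V - (insert b T).card) ?_ (insert b T) (insert s(a, b) F)
        (Finset.insert_subset hab hF) rfl (Finset.mem_insert_of_mem hr) ?_ ?_
      · rw [Finset.card_insert_of_notMem hb]; omega
      · intro x hx c hc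
        rcases Finset.mem_insert.1 hx with rfl | hx
        · rcases Sym2.mem_iff.1 hc with rfl | rfl
          · exact Finset.mem_insert_of_mem ha
          · exact Finset.mem_insert_self _ _
        · exact Finset.mem_insert_of_mem (hFT x hx c hc)
      · rw [Finset.card_insert_of_notMem hb, Finset.card_insert_of_notMem hbF]; omega

/-- The set of edges of the closed walk `w 0, w 1, …, w k, w 0`. -/
def closedWalkEdges {V : Type*} [DecidableEq V] {k : ℕ} (w : Fin (k + 1) → V) :
    Finset (Sym2 V) :=
  Finset.univ.image fun i ↦ s(w i, w (i + 1))

/-! ### Vertices and edges in the union of two closed walks -/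

section Walks

variable {V : Type*} [DecidableEq V] {k : ℕ}

lemma mem_closedWalkEdges (w : Fin (k + 1) → V) (i : Fin (k + 1)) :
    s(w i, w (i + 1)) ∈ closedWalkEdges w :=
  Finset.mem_image_of_mem _ (Finset.mem_univ i)

lemma card_closedWalkEdges_le (w : Fin (k + 1) → V) : (closedWalkEdges w).card ≤ k + 1 :=
  Finset.card_image_le.trans (by simp)

lemma card_closedWalkEdges_pos (w : Fin (k + 1) → V) : 0 < (closedWalkEdges w).card :=
  Finset.card_pos.2 ⟨_, mem_closedWalkEdges w 0⟩

/-- A set containing one vertex of a closed walk and closed under all its steps but the one at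
`c` contains all its vertices. -/
lemma forall_mem_of_closed_of_ne {V : Type*} (w : Fin (k + 1) → V) (T : Finset V) (c : Fin (k + 1))
    (hfw : ∀ i, i ≠ c → (w i ∈ T ↔ w (i + 1) ∈ T)) (a : Fin (k + 1)) (ha : w a ∈ T)
    (b : Fin (k + 1)) : w b ∈ T := by
  -- Cutting the cycle at `c` leaves the path `c + 1, c + 2, …, c`, along which membership in `T`
  -- propagates.
  have key : ∀ j : ℕ, j ≤ k → (w (c + 1) ∈ T ↔ w (c + 1 + Fin.ofNat (k + 1) j) ∈ T) := by
    intro j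
    induction j with
    | zero => intro _; simp
    | succ j ih =>
      intro hj
      rw [ih (by omega), hfw]
      · have : (Fin.ofNat (k + 1) (j + 1)) = Fin.ofNat (k + 1) j + 1 := by
          ext; simp [Fin.val_add]
        rw [this, add_assoc]
      · intro h
        have h1 : (1 : Fin (k + 1)) + Fin.ofNat (k + 1) j = 0 := by
          rwa [add_assoc, add_eq_left] at h
        have h2 := congrArg Fin.val h1
        have h3 : (1 : Fin (k + 1)) = Fin.ofNat (k + 1) 1 := rfl
        rw [h3] at h2
        simp only [Fin.val_add, Fin.val_ofNat, Fin.val_zero, Nat.add_mod_mod, Nat.mod_add_mod] at h2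
        rw [Nat.mod_eq_of_lt (by omega)] at h2
        omega
  have all : ∀ x, (w (c + 1) ∈ T ↔ w x ∈ T) := by
    intro x
    have := key (x - (c + 1)).val (by omega)
    have h4 : Fin.ofNat (k + 1) (x - (c + 1)).val = x - (c + 1) := by
      ext; simp
    rwa [h4, add_sub_cancel] at this
  exact (all b).1 ((all a).2 ha)

/-- The position `i` carries a vertex that `φ` takes nowhere else. -/
def IsSingleAt {V κ : Type*} (φ : κ → V) (i : κ) : Prop := ∀ j, φ j = φ i → j = i

/-- Count by fibres: a fibre of size 1 contributes 0 + 2 to the left and 2 to the right, and a fibre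
of size f ≥ 2 contributes f + 2 ≤ 2f. -/
lemma card_not_isSingleAt_add_le {κ : Type*} [Fintype κ] [DecidableEq κ] (φ : κ → V)
    [DecidablePred (IsSingleAt φ)] :
    (Finset.univ.filter fun i ↦ ¬ IsSingleAt φ i).card + 2 * (Finset.univ.image φ).card
      ≤ 2 * Fintype.card κ := by
  have hmaps : ∀ s : Finset κ, ∀ i ∈ s, φ i ∈ Finset.univ.image φ := fun s i _ ↦
    Finset.mem_image_of_mem _ (Finset.mem_univ i)
  rw [Finset.card_eq_sum_card_fiberwise (hmaps _), ← Finset.card_univ,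
    Finset.card_eq_sum_card_fiberwise (hmaps Finset.univ), Finset.mul_sum, Finset.card_eq_sum_ones,
    Finset.mul_sum, ← Finset.sum_add_distrib]
  refine Finset.sum_le_sum fun x hx ↦ ?_
  obtain ⟨i, -, rfl⟩ := Finset.mem_image.1 hx
  by_cases hs : IsSingleAt φ i
  · have h0 : (Finset.univ.filter fun j ↦ ¬ IsSingleAt φ j).filter (fun j ↦ φ j = φ i) = ∅ := by
      refine Finset.filter_eq_empty_iff.2 fun j hj hji ↦ ?_
      exact (Finset.mem_filter.1 hj).2 (hs j hji ▸ hs)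
    have h1 : 0 < (Finset.univ.filter fun j ↦ φ j = φ i).card :=
      Finset.card_pos.2 ⟨i, by simp⟩
    rw [h0, Finset.card_empty]; omega
  · have hle : ((Finset.univ.filter fun j ↦ ¬ IsSingleAt φ j).filter fun j ↦ φ j = φ i).card ≤
        (Finset.univ.filter fun j ↦ φ j = φ i).card :=
      Finset.card_le_card (Finset.filter_subset_filter _ (Finset.subset_univ _))
    have h2 : 1 < (Finset.univ.filter fun j ↦ φ j = φ i).card := by
      unfold IsSingleAt at hs
      push Not at hs
      obtain ⟨j, hj, hne⟩ := hs
      exact Finset.one_lt_card.2 ⟨j, by simp [hj], i, by simp, hne⟩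
    omega

/-- A set of positions on a cycle without two consecutive elements fills at most half of it. -/
lemma two_mul_card_le_of_no_consecutive (S : Finset (Fin (k + 1)))
    (h : ∀ i, i ∈ S → i + 1 ∉ S) : 2 * S.card ≤ k + 1 := by
  have hd : Disjoint S (S.image (· + 1)) := by
    rw [Finset.disjoint_right]
    intro x hx
    obtain ⟨i, hi, rfl⟩ := Finset.mem_image.1 hx
    exact h i hi
  have hc : (S.image (· + 1)).card = S.card :=
    Finset.card_image_of_injective _ (add_left_injective 1)
  have := Finset.card_le_univ (S ∪ S.image (· + 1))
  rw [Finset.card_union_of_disjoint hd, hc, Fintype.card_fin] at this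
  omega

lemma fin_add_one_add_one_ne_self (hk : 2 ≤ k) (i : Fin (k + 1)) : i + 1 + 1 ≠ i := by
  intro h
  rw [add_assoc, add_eq_left] at h
  have h2 := congrArg Fin.val h
  have h3 : (1 : Fin (k + 1)) = Fin.ofNat (k + 1) 1 := rfl
  rw [h3] at h2
  simp only [Fin.val_add, Fin.val_ofNat, Fin.val_zero, Nat.add_mod_mod, Nat.mod_add_mod] at h2
  rw [Nat.mod_eq_of_lt (by omega)] at h2
  omega

lemma fin_add_one_ne_self (hk : 1 ≤ k) (i : Fin (k + 1)) : i + 1 ≠ i := by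
  intro h
  rw [add_eq_left] at h
  have h2 := congrArg Fin.val h
  have h3 : (1 : Fin (k + 1)) = Fin.ofNat (k + 1) 1 := rfl
  rw [h3] at h2
  simp only [Fin.val_ofNat, Fin.val_zero] at h2
  rw [Nat.mod_eq_of_lt (by omega)] at h2
  omega

/-- The set of vertices visited by a pair of walks. -/
def pairVerts {κ κ' : Type*} [Fintype κ] [Fintype κ'] (w : κ → V) (w' : κ' → V) : Finset V :=
  Finset.univ.image (Sum.elim w w')

lemma mem_pairVerts {κ κ' : Type*} [Fintype κ] [Fintype κ'] {w : κ → V} {w' : κ' → V} {x : V} :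
    x ∈ pairVerts w w' ↔ (∃ i, w i = x) ∨ ∃ j, w' j = x := by
  simp [pairVerts]

variable [Fintype V]

/-- The union is connected, because the walks meet at `w a = w' b`. -/
lemma card_pairVerts_le (w w' : Fin (k + 1) → V) {a b : Fin (k + 1)} (hab : w a = w' b) :
    (pairVerts w w').card ≤ (closedWalkEdges w ∪ closedWalkEdges w').card + 1 := by
  refine card_le_card_edges_add_one _ _ (w a) fun T hr hcl ↦ ?_
  have hw : ∀ i, w i ∈ T := forall_mem_of_closed_of_ne w T a (fun i _ ↦
    ⟨hcl _ _ (Finset.mem_union_left _ (mem_closedWalkEdges w i)),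
      hcl _ _ (Finset.mem_union_left _ (Sym2.eq_swap ▸ mem_closedWalkEdges w i))⟩) a hr
  have hw' : ∀ i, w' i ∈ T := forall_mem_of_closed_of_ne w' T b (fun i _ ↦
    ⟨hcl _ _ (Finset.mem_union_right _ (mem_closedWalkEdges w' i)),
      hcl _ _ (Finset.mem_union_right _ (Sym2.eq_swap ▸ mem_closedWalkEdges w' i))⟩) b
      (hab ▸ hr)
  intro x hx
  obtain ⟨i, rfl⟩ | ⟨i, rfl⟩ := (mem_pairVerts.1 hx).symm
  · exact hw' i
  · exact hw i

/-- An edge between two consecutive singly visited positions is covered only once. -/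
lemma eq_of_edge_eq_of_isSingleAt {V κ : Type*} {φ : κ → V} {w : Fin (k + 1) → V}
    (hk : 2 ≤ k) (g : Fin (k + 1) → κ) (hg : Function.Injective g) (hφ : ∀ i, φ (g i) = w i)
    {c : Fin (k + 1)} (h0 : IsSingleAt φ (g c)) (h1 : IsSingleAt φ (g (c + 1))) {i : Fin (k + 1)}
    (h : s(w i, w (i + 1)) = s(w c, w (c + 1))) : i = c := by
  simp only [← hφ] at h
  rcases Sym2.eq_iff.1 h with ⟨h2, -⟩ | ⟨h2, h3⟩
  · exact hg (h0 _ h2)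
  · have h4 := hg (h1 _ h2)
    have h5 := hg (h0 _ h3)
    exact absurd (h4 ▸ h5) (fin_add_one_add_one_ne_self hk c)

/-- An edge joining two consecutive positions whose vertices occur nowhere else is traversed exactly
once. Deleting one such edge from each walk turns both cycles into paths that still meet, so a
connected graph remains with two edges fewer. -/
lemma card_pairVerts_add_one_le (hk : 2 ≤ k) (w w' : Fin (k + 1) → V) {a b : Fin (k + 1)}
    (hab : w a = w' b) {c d : Fin (k + 1)}
    (hc : IsSingleAt (Sum.elim w w') (.inl c)) (hc' : IsSingleAt (Sum.elim w w') (.inl (c + 1)))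
    (hd : IsSingleAt (Sum.elim w w') (.inr d)) (hd' : IsSingleAt (Sum.elim w w') (.inr (d + 1))) :
    (pairVerts w w').card + 1 ≤ (closedWalkEdges w ∪ closedWalkEdges w').card := by
  set E := closedWalkEdges w ∪ closedWalkEdges w' with hE
  set f₁ := s(w c, w (c + 1))
  set f₂ := s(w' d, w' (d + 1))
  have hcross : ∀ i, s(w i, w (i + 1)) ≠ f₂ := by
    intro i h
    have hmem : w i ∈ f₂ := h ▸ Sym2.mem_mk_left _ _
    rcases Sym2.mem_iff.1 hmem with h | h
    · exact absurd (hd (.inl i) (by simpa using h)) (by simp)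
    · exact absurd (hd' (.inl i) (by simpa using h)) (by simp)
  have hcross' : ∀ i, s(w' i, w' (i + 1)) ≠ f₁ := by
    intro i h
    have hmem : w' i ∈ f₁ := h ▸ Sym2.mem_mk_left _ _
    rcases Sym2.mem_iff.1 hmem with h | h
    · exact absurd (hc (.inr i) (by simpa using h)) (by simp)
    · exact absurd (hc' (.inr i) (by simpa using h)) (by simp)
  have hf₁ : f₁ ∈ E := Finset.mem_union_left _ (mem_closedWalkEdges w c)
  have hf₂ : f₂ ∈ E.erase f₁ := Finset.mem_erase.2
    ⟨hcross' d, Finset.mem_union_right _ (mem_closedWalkEdges w' d)⟩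
  have hcard : ((E.erase f₁).erase f₂).card + 2 = E.card := by
    have e1 := Finset.card_erase_add_one hf₁
    have e2 := Finset.card_erase_add_one hf₂
    omega
  suffices (pairVerts w w').card ≤ ((E.erase f₁).erase f₂).card + 1 by omega
  refine card_le_card_edges_add_one _ _ (w a) fun T hr hcl ↦ ?_
  have hin : ∀ i, i ≠ c → s(w i, w (i + 1)) ∈ (E.erase f₁).erase f₂ := fun i hi ↦
    Finset.mem_erase.2 ⟨hcross i, Finset.mem_erase.2 ⟨fun h ↦ hi
      (eq_of_edge_eq_of_isSingleAt (φ := Sum.elim w w') hk Sum.inl Sum.inl_injective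
        (fun _ ↦ rfl) hc hc' h), Finset.mem_union_left _ (mem_closedWalkEdges w i)⟩⟩
  have hin' : ∀ i, i ≠ d → s(w' i, w' (i + 1)) ∈ (E.erase f₁).erase f₂ := fun i hi ↦
    Finset.mem_erase.2 ⟨fun h ↦ hi
      (eq_of_edge_eq_of_isSingleAt (φ := Sum.elim w w') hk Sum.inr Sum.inr_injective
        (fun _ ↦ rfl) hd hd' h), Finset.mem_erase.2 ⟨hcross' i,
          Finset.mem_union_right _ (mem_closedWalkEdges w' i)⟩⟩
  have hw : ∀ i, w i ∈ T := forall_mem_of_closed_of_ne w T c (fun i hi ↦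
    ⟨hcl _ _ (hin i hi), hcl _ _ (Sym2.eq_swap ▸ hin i hi)⟩) a hr
  have hw' : ∀ i, w' i ∈ T := forall_mem_of_closed_of_ne w' T d (fun i hi ↦
    ⟨hcl _ _ (hin' i hi), hcl _ _ (Sym2.eq_swap ▸ hin' i hi)⟩) b (hab ▸ hr)
  intro x hx
  obtain ⟨i, rfl⟩ | ⟨i, rfl⟩ := (mem_pairVerts.1 hx).symm
  · exact hw' i
  · exact hw i

/-- Either the union of two closed walks sharing a vertex has two independent cycles, or the walks
repeat many vertices. -/
lemma card_pairVerts_add_one_le_or (hk : 2 ≤ k) (w w' : Fin (k + 1) → V) {a b : Fin (k + 1)}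
    (hab : w a = w' b) :
    (pairVerts w w').card + 1 ≤ (closedWalkEdges w ∪ closedWalkEdges w').card ∨
      (k + 1) + 4 * (pairVerts w w').card ≤ 8 * (k + 1) := by
  classical
  have hns := card_not_isSingleAt_add_le (Sum.elim w w')
  rw [Fintype.card_sum, Fintype.card_fin] at hns
  change _ + 2 * (pairVerts w w').card ≤ _ at hns
  have side : ∀ g : Fin (k + 1) → Fin (k + 1) ⊕ Fin (k + 1), Function.Injective g →
      (∃ c, IsSingleAt (Sum.elim w w') (g c) ∧ IsSingleAt (Sum.elim w w') (g (c + 1))) ∨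
        (k + 1) + 4 * (pairVerts w w').card ≤ 8 * (k + 1) := by
    intro g hg
    by_cases hex : ∃ c, IsSingleAt (Sum.elim w w') (g c) ∧ IsSingleAt (Sum.elim w w') (g (c + 1))
    · exact Or.inl hex
    · right
      push Not at hex
      -- At least half of the `k + 1` positions of this walk are not single, while over both walks
      -- there are at most 2(2(k + 1) - v) such positions, v being the number of vertices.
      have h1 := two_mul_card_le_of_no_consecutive
        (Finset.univ.filter fun c ↦ IsSingleAt (Sum.elim w w') (g c)) (by simpa using hex)
      have h2 : ((Finset.univ.filter fun c ↦ ¬ IsSingleAt (Sum.elim w w') (g c)).image g).card ≤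
          (Finset.univ.filter fun i ↦ ¬ IsSingleAt (Sum.elim w w') i).card := by
        refine Finset.card_le_card fun x hx ↦ ?_
        obtain ⟨c, hc, rfl⟩ := Finset.mem_image.1 hx
        simpa using hc
      rw [Finset.card_image_of_injective _ hg] at h2
      have h3 := Finset.card_filter_add_card_filter_not (s := (Finset.univ : Finset (Fin (k + 1))))
        (fun c ↦ IsSingleAt (Sum.elim w w') (g c))
      rw [Finset.card_univ, Fintype.card_fin] at h3
      omega
  rcases side Sum.inl Sum.inl_injective with ⟨c, hc, hc'⟩ | h
  · rcases side Sum.inr Sum.inr_injective with ⟨d, hd, hd'⟩ | h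
    · exact Or.inl (card_pairVerts_add_one_le hk w w' hab hc hc' hd hd')
    · exact Or.inr h
  · exact Or.inr h

end Walks

/-! ### Weighted counts of maps and of pairs of walks -/

section Counting

variable {V : Type*} [DecidableEq V] [Fintype V]

/-- Each further coordinate either takes a new value, for a factor of at most `Fintype.card V * y`,
or repeats one of at most `K` earlier values at no cost in weight. -/
lemma sum_pow_card_image_le {y : ℝ} (hy : 0 ≤ y) (K : ℕ) (k : ℕ) (hk : k ≤ K) :
    ∑ φ : Fin k → V, y ^ (Finset.univ.image φ).card ≤ (Fintype.card V * y + K) ^ k := by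
  induction k with
  | zero => simp
  | succ k ih =>
    rw [← (Fin.consEquiv fun _ ↦ V).sum_comp, Fintype.sum_prod_type_right, pow_succ]
    have hC : (0 : ℝ) ≤ Fintype.card V * y + K := by positivity
    refine le_trans ?_ (mul_le_mul_of_nonneg_right (ih (by omega)) hC)
    rw [Finset.sum_mul]
    refine Finset.sum_le_sum fun φ _ ↦ ?_
    have him : ∀ x : V, (Finset.univ.image ((Fin.consEquiv fun _ ↦ V) (x, φ))) =
        insert x (Finset.univ.image φ) := by
      intro x
      ext z
      simp [Fin.consEquiv, Fin.exists_fin_succ, eq_comm]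
    simp only [him]
    set I := Finset.univ.image φ with hI
    have hIc : (I.card : ℝ) ≤ K := by
      have : I.card ≤ k := Finset.card_image_le.trans (by simp)
      exact_mod_cast (by omega : I.card ≤ K)
    calc ∑ x, y ^ (insert x I).card
        ≤ ∑ x, ((if x ∈ I then y ^ I.card else 0) + y * y ^ I.card) := by
          refine Finset.sum_le_sum fun x _ ↦ ?_
          by_cases hx : x ∈ I
          · simp only [Finset.insert_eq_of_mem hx, hx, if_true]
            have : 0 ≤ y * y ^ I.card := by positivity
            linarith
          · simp only [Finset.card_insert_of_notMem hx, hx, if_false]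
            rw [pow_succ']; simp
      _ = (I.card + Fintype.card V * y) * y ^ I.card := by
          rw [Finset.sum_add_distrib, ← Finset.sum_filter]
          simp only [Finset.filter_mem_eq_inter, Finset.univ_inter, Finset.sum_const,
            Finset.card_univ, nsmul_eq_mul]
          ring
      _ ≤ y ^ I.card * (Fintype.card V * y + K) := by
          rw [mul_comm]
          refine mul_le_mul_of_nonneg_left (by linarith) (by positivity)

lemma sum_pow_card_image_le' {κ : Type*} [Fintype κ] [DecidableEq κ] {y : ℝ} (hy : 0 ≤ y) :
    ∑ φ : κ → V, y ^ (Finset.univ.image φ).card ≤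
      (Fintype.card V * y + Fintype.card κ) ^ Fintype.card κ := by
  refine le_trans (le_of_eq ?_) (sum_pow_card_image_le (V := V) hy _ (Fintype.card κ) le_rfl)
  refine Fintype.sum_equiv ((Fintype.equivFin κ).arrowCongr (Equiv.refl V)) _ _ fun φ ↦ ?_
  congr 2
  ext z
  simp only [Finset.mem_image, Finset.mem_univ, true_and, Equiv.arrowCongr_apply,
    Equiv.coe_refl, Function.comp, id]
  exact (Equiv.exists_congr_left (Fintype.equivFin κ))

/-- Maps with `d` coincidences are rarer than all maps by the factor `(K² / (np)) ^ d`. -/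
lemma sum_pow_card_image_of_coincidences_le {κ : Type*} [Fintype κ] [DecidableEq κ] {p : ℝ} (hp : 0 < p)
    (hK : 0 < Fintype.card κ) (d : ℕ)
    (hθ : (Fintype.card κ : ℝ) ^ 2 ≤ Fintype.card V * p) :
    ∑ φ : κ → V, (if (Finset.univ.image φ).card + d ≤ Fintype.card κ then
        p ^ (Finset.univ.image φ).card else 0) ≤
      3 * (Fintype.card V * p) ^ Fintype.card κ *
        ((Fintype.card κ : ℝ) ^ 2 / (Fintype.card V * p)) ^ d := by
  set K := Fintype.card κ with hKdef
  set n := Fintype.card V with hn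
  have hKr : (0 : ℝ) < K := by exact_mod_cast hK
  have hnp : (0 : ℝ) < n * p := lt_of_lt_of_le (by positivity) hθ
  -- Exponential tilting: on maps with at least `d` coincidences, `θ ^ (K - d - v) ≥ 1`, with v the
  -- image size. This choice of `θ` makes `n * (p / θ) = K ^ 2`, so the untilted sum costs only `(1
  -- + 1 / K) ^ K ≤ e < 3`.
  set θ : ℝ := n * p / K ^ 2 with hθd
  have hθ1 : 1 ≤ θ := by rw [hθd, le_div_iff₀ (by positivity)]; linarith
  have hθ0 : 0 < θ := by linarith
  calc ∑ φ : κ → V, (if (Finset.univ.image φ).card + d ≤ K then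
        p ^ (Finset.univ.image φ).card else 0)
      ≤ ∑ φ : κ → V, θ ^ K / θ ^ d * (p / θ) ^ (Finset.univ.image φ).card := by
        refine Finset.sum_le_sum fun φ _ ↦ ?_
        split_ifs with h
        · set v := (Finset.univ.image φ).card
          obtain ⟨r, hr⟩ := Nat.exists_eq_add_of_le h
          rw [hr, pow_add, pow_add, div_pow p θ]
          have : θ ^ v * θ ^ d * θ ^ r / θ ^ d * (p ^ v / θ ^ v) = θ ^ r * p ^ v := by
            field_simp
          rw [this]
          have h1 : 1 ≤ θ ^ r := one_le_pow₀ hθ1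
          nlinarith [pow_pos hp v]
        · positivity
    _ ≤ θ ^ K / θ ^ d * (n * (p / θ) + K) ^ K := by
        rw [← Finset.mul_sum]
        exact mul_le_mul_of_nonneg_left (sum_pow_card_image_le' (by positivity)) (by positivity)
    _ = (n * p) ^ K * ((K : ℝ) ^ 2 / (n * p)) ^ d * (1 + 1 / K) ^ K := by
        have h1 : θ ^ K * (n * (p / θ) + K) ^ K = (n * p) ^ K * (1 + 1 / K) ^ K := by
          rw [← mul_pow, ← mul_pow]
          congr 1
          rw [hθd]
          have : (n : ℝ) ≠ 0 := by rintro h; simp [h] at hnp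
          field_simp
        have h2 : ((K : ℝ) ^ 2 / (n * p)) = θ⁻¹ := by rw [hθd, inv_div]
        rw [h2, inv_pow, div_mul_eq_mul_div, h1]
        ring
    _ ≤ (n * p) ^ K * ((K : ℝ) ^ 2 / (n * p)) ^ d * 3 := by
        refine mul_le_mul_of_nonneg_left ?_ (by positivity)
        have h1 : (1 + 1 / (K : ℝ)) ^ K ≤ Real.exp 1 := by
          calc (1 + 1 / (K : ℝ)) ^ K ≤ Real.exp (1 / K) ^ K := by
                refine pow_le_pow_left₀ (by positivity) ?_ K
                rw [add_comm]; exact Real.add_one_le_exp _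
            _ = Real.exp 1 := by
                rw [← Real.exp_nat_mul]; congr 1; field_simp
        exact h1.trans (by have := Real.exp_one_lt_d9; linarith)
    _ = _ := by ring

lemma card_filter_two_values {κ : Type*} [Fintype κ] [DecidableEq κ] {i j : κ} (hij : i ≠ j)
    (a b : V) :
    ((Finset.univ.filter fun w : κ → V ↦ w i = a ∧ w j = b).card) =
      Fintype.card V ^ (Fintype.card κ - 2) := by
  have h : (Finset.univ.filter fun w : κ → V ↦ w i = a ∧ w j = b) =
      Fintype.piFinset fun l ↦ if l = i then {a} else if l = j then {b} else Finset.univ := by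
    ext w
    simp only [Finset.mem_filter, Finset.mem_univ, true_and, Fintype.mem_piFinset]
    constructor
    · rintro ⟨rfl, rfl⟩ l
      split_ifs with h1 h2
      · simp [h1]
      · simp [h2]
      · simp
    · intro h
      exact ⟨by simpa using h i, by simpa [hij.symm] using h j⟩
  rw [h, Fintype.card_piFinset]
  have h2 : ∀ l, (if l = i then ({a} : Finset V) else if l = j then {b} else Finset.univ).card =
      if l ∈ ({i, j} : Finset κ) then 1 else Fintype.card V := by
    intro l
    by_cases h1 : l = i
    · simp [h1]
    · by_cases h3 : l = j
      · simp [h3, hij.symm]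
      · simp [h1, h3]
  simp only [h2]
  rw [Finset.prod_ite, Finset.prod_const_one, one_mul, Finset.prod_const]
  congr 1
  have := Finset.card_filter_add_card_filter_not (s := (Finset.univ : Finset κ))
    (fun l ↦ l ∈ ({i, j} : Finset κ))
  have h4 : (Finset.univ.filter fun l ↦ l ∈ ({i, j} : Finset κ)) = {i, j} := by ext; simp
  rw [h4, Finset.card_pair hij, Finset.card_univ] at this
  omega

variable {k : ℕ}

/-- The number of pairs of closed walks sharing an edge. -/
lemma card_pairs_sharing_edge_le (hk : 1 ≤ k) :
    (Finset.univ.filter fun x : (Fin (k + 1) → V) × (Fin (k + 1) → V) ↦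
        (closedWalkEdges x.1 ∩ closedWalkEdges x.2).Nonempty).card ≤
      2 * (k + 1) ^ 2 * Fintype.card V ^ (2 * (k + 1) - 2) := by
  have hsub : (Finset.univ.filter fun x : (Fin (k + 1) → V) × (Fin (k + 1) → V) ↦
        (closedWalkEdges x.1 ∩ closedWalkEdges x.2).Nonempty) ⊆
      -- Choose `w` freely, then the two positions of the common edge and its orientation; this
      -- fixes two values of `w'`.
      (Finset.univ : Finset (Fin (k + 1) → V)).biUnion fun w ↦
        (Finset.univ : Finset (Fin (k + 1) × Fin (k + 1))).biUnion fun ij ↦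
          ((Finset.univ.filter fun w' : Fin (k + 1) → V ↦
              w' ij.2 = w ij.1 ∧ w' (ij.2 + 1) = w (ij.1 + 1)) ∪
            (Finset.univ.filter fun w' : Fin (k + 1) → V ↦
              w' ij.2 = w (ij.1 + 1) ∧ w' (ij.2 + 1) = w ij.1)).image fun w' ↦ (w, w') := by
    rintro ⟨w, w'⟩ hx
    obtain ⟨e, he⟩ := (Finset.mem_filter.1 hx).2
    obtain ⟨h1, h2⟩ := Finset.mem_inter.1 he
    obtain ⟨i, -, rfl⟩ := Finset.mem_image.1 h1
    obtain ⟨j, -, hj⟩ := Finset.mem_image.1 h2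
    simp only [Finset.mem_biUnion, Finset.mem_univ, true_and, Finset.mem_image]
    refine ⟨w, (i, j), w', ?_, rfl⟩
    simpa using Sym2.eq_iff.1 hj
  refine (Finset.card_le_card hsub).trans ?_
  refine (Finset.card_biUnion_le_card_mul _ _
    ((k + 1) ^ 2 * (2 * Fintype.card V ^ (k + 1 - 2))) fun w _ ↦ ?_).trans ?_
  · refine (Finset.card_biUnion_le_card_mul _ _ (2 * Fintype.card V ^ (k + 1 - 2))
      fun ij _ ↦ ?_).trans ?_
    · refine Finset.card_image_le.trans ((Finset.card_union_le _ _).trans ?_)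
      have hne : ij.2 ≠ ij.2 + 1 := (fin_add_one_ne_self hk _).symm
      rw [card_filter_two_values hne, card_filter_two_values hne, Fintype.card_fin]
      omega
    · simp [sq]
  · rw [Finset.card_univ, Fintype.card_fun, Fintype.card_fin]
    have : 2 * (k + 1) - 2 = (k + 1) + (k + 1 - 2) := by omega
    rw [this, pow_add]
    exact le_of_eq (by ring)

/-- The weighted number of pairs of closed walks sharing an edge. -/
lemma sum_card_inter_mul_pow_le (hk : 2 ≤ k) {p : ℝ} (hp : 0 < p) (hp1 : p ≤ 1) (d : ℕ)
    (hd : 4 * d ≤ k + 1 + 3)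
    (hθ : ((2 * (k + 1) : ℕ) : ℝ) ^ 2 ≤ Fintype.card V * p) :
    ∑ w : Fin (k + 1) → V, ∑ w' : Fin (k + 1) → V,
        ((closedWalkEdges w ∩ closedWalkEdges w').card : ℝ) *
          p ^ (closedWalkEdges w ∪ closedWalkEdges w').card ≤
      2 * (k + 1) ^ 2 * Fintype.card V ^ (2 * (k + 1) - 2) * p ^ (2 * (k + 1) - 1) +
      (k + 1) * 3 * (Fintype.card V * p) ^ (2 * (k + 1)) *
        (p * (((2 * (k + 1) : ℕ) : ℝ) ^ 2 / (Fintype.card V * p)) ^ 3 +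
          p⁻¹ * (((2 * (k + 1) : ℕ) : ℝ) ^ 2 / (Fintype.card V * p)) ^ d) := by
  have hcard : Fintype.card (Fin (k + 1) ⊕ Fin (k + 1)) = 2 * (k + 1) := by simp; ring
  have hcoin : ∀ d : ℕ, ∑ x : (Fin (k + 1) → V) × (Fin (k + 1) → V),
      (if (pairVerts x.1 x.2).card + d ≤ 2 * (k + 1) then p ^ (pairVerts x.1 x.2).card else 0) ≤
      3 * (Fintype.card V * p) ^ (2 * (k + 1)) *
        (((2 * (k + 1) : ℕ) : ℝ) ^ 2 / (Fintype.card V * p)) ^ d := by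
    intro d
    have h := sum_pow_card_image_of_coincidences_le (V := V) (κ := Fin (k + 1) ⊕ Fin (k + 1)) hp
      (by omega) d (by rw [hcard]; exact hθ)
    rw [hcard] at h
    refine le_trans (le_of_eq ?_) h
    refine (Fintype.sum_equiv (Equiv.sumArrowEquivProdArrow (Fin (k + 1)) (Fin (k + 1)) V)
      _ _ fun φ ↦ ?_).symm
    have : Sum.elim (φ ∘ Sum.inl) (φ ∘ Sum.inr) = φ := Sum.elim_comp_inl_inr φ
    simp only [pairVerts, Equiv.sumArrowEquivProdArrow, Equiv.coe_fn_mk, this]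
  rw [← Fintype.sum_prod_type']
  -- The three summands cover the main pairs, the pairs with two independent cycles and at least 3
  -- coincidences, and the pairs with at least `d` coincidences.
  have hpt : ∀ x : (Fin (k + 1) → V) × (Fin (k + 1) → V),
      ((closedWalkEdges x.1 ∩ closedWalkEdges x.2).card : ℝ) *
          p ^ (closedWalkEdges x.1 ∪ closedWalkEdges x.2).card ≤
        (if (closedWalkEdges x.1 ∩ closedWalkEdges x.2).Nonempty then p ^ (2 * (k + 1) - 1) else 0)
        + (k + 1) * (p * (if (pairVerts x.1 x.2).card + 3 ≤ 2 * (k + 1) then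
            p ^ (pairVerts x.1 x.2).card else 0) +
          p⁻¹ * (if (pairVerts x.1 x.2).card + d ≤ 2 * (k + 1) then
            p ^ (pairVerts x.1 x.2).card else 0)) := by
    rintro ⟨w, w'⟩
    simp only
    set E := closedWalkEdges w with hE
    set E' := closedWalkEdges w' with hE'
    set v := (pairVerts w w').card with hv
    have hb3 : (0 : ℝ) ≤ p * (if v + 3 ≤ 2 * (k + 1) then p ^ v else 0) := by
      split_ifs <;> positivity
    have hbd : (0 : ℝ) ≤ p⁻¹ * (if v + d ≤ 2 * (k + 1) then p ^ v else 0) := by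
      split_ifs <;> positivity
    by_cases hne : (E ∩ E').Nonempty
    · rw [if_pos hne]
      have hsk : ((E ∩ E').card : ℝ) ≤ k + 1 := by
        exact_mod_cast (Finset.card_le_card Finset.inter_subset_left).trans
          (card_closedWalkEdges_le w)
      obtain ⟨a, b, hab⟩ : ∃ a b, w a = w' b := by
        obtain ⟨e, he⟩ := hne
        obtain ⟨h1, h2⟩ := Finset.mem_inter.1 he
        obtain ⟨i, -, rfl⟩ := Finset.mem_image.1 h1
        obtain ⟨j, -, hj⟩ := Finset.mem_image.1 h2
        rcases Sym2.eq_iff.1 hj with ⟨h, -⟩ | ⟨-, h⟩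
        exacts [⟨i, j, h.symm⟩, ⟨i, j + 1, h.symm⟩]
      have h1 := card_pairVerts_le w w' hab
      have h2 := card_pairVerts_add_one_le_or hk w w' hab
      rw [← hE, ← hE', ← hv] at h1 h2
      rcases h2 with h | h
      · by_cases h3 : v + 3 ≤ 2 * (k + 1)
        · have hpe : p ^ (E ∪ E').card ≤ p * p ^ v := by
            rw [← pow_succ']; exact pow_le_pow_of_le_one hp.le hp1 h
          rw [if_pos h3] at hb3 ⊢
          have h5 : ((E ∩ E').card : ℝ) * p ^ (E ∪ E').card ≤ (k + 1) * (p * p ^ v) :=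
            mul_le_mul hsk hpe (by positivity) (by positivity)
          have h6 : 0 ≤ p ^ (2 * (k + 1) - 1) := by positivity
          have h7 : (0 : ℝ) ≤ (k + 1) * (p⁻¹ * (if v + d ≤ 2 * (k + 1) then p ^ v else 0)) := by
            positivity
          linarith
        -- Here `v ≥ 2 * (k + 1) - 2`, so the union has at least `2 * (k + 1) - 1` edges, which
        -- leaves room for at most one common edge.
        · have h4 := Finset.card_union_add_card_inter E E'
          have h5 : E.card ≤ k + 1 := card_closedWalkEdges_le w
          have h6 : E'.card ≤ k + 1 := card_closedWalkEdges_le w'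
          have h7 : (E ∩ E').card ≤ 1 := by omega
          have h8 : ((E ∩ E').card : ℝ) ≤ 1 := by exact_mod_cast h7
          have hpe : p ^ (E ∪ E').card ≤ p ^ (2 * (k + 1) - 1) :=
            pow_le_pow_of_le_one hp.le hp1 (by omega)
          have h9 : ((E ∩ E').card : ℝ) * p ^ (E ∪ E').card ≤ 1 * p ^ (2 * (k + 1) - 1) :=
            mul_le_mul h8 hpe (by positivity) (by positivity)
          have h10 : (0 : ℝ) ≤ (k + 1) * (p * (if v + 3 ≤ 2 * (k + 1) then p ^ v else 0) +
            p⁻¹ * (if v + d ≤ 2 * (k + 1) then p ^ v else 0)) := by positivity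
          linarith
      -- Only connectedness is available here, so one factor `p⁻¹` is lost.
      · have hvd : v + d ≤ 2 * (k + 1) := by omega
        rw [if_pos hvd] at hbd ⊢
        have hpe : p ^ (E ∪ E').card ≤ p⁻¹ * p ^ v := by
          rw [inv_mul_eq_div, le_div_iff₀ hp, ← pow_succ]
          exact pow_le_pow_of_le_one hp.le hp1 h1
        have h5 : ((E ∩ E').card : ℝ) * p ^ (E ∪ E').card ≤ (k + 1) * (p⁻¹ * p ^ v) :=
          mul_le_mul hsk hpe (by positivity) (by positivity)
        have h6 : 0 ≤ p ^ (2 * (k + 1) - 1) := by positivity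
        have h7 : (0 : ℝ) ≤ (k + 1) * (p * (if v + 3 ≤ 2 * (k + 1) then p ^ v else 0)) := by
          positivity
        linarith
    · have h0 : (E ∩ E').card = 0 := by
        rw [Finset.card_eq_zero]; exact Finset.not_nonempty_iff_eq_empty.1 hne
      rw [h0, if_neg hne]
      simp only [Nat.cast_zero, zero_mul, zero_add]
      positivity
  refine (Finset.sum_le_sum fun x _ ↦ hpt x).trans ?_
  rw [Finset.sum_add_distrib, ← Finset.mul_sum, Finset.sum_add_distrib, ← Finset.mul_sum,
    ← Finset.mul_sum]
  refine add_le_add ?_ ?_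
  · rw [← Finset.sum_filter, Finset.sum_const, nsmul_eq_mul]
    refine mul_le_mul_of_nonneg_right ?_ (by positivity)
    exact_mod_cast card_pairs_sharing_edge_le (V := V) (k := k) (by omega)
  · have h3 := mul_le_mul_of_nonneg_left (hcoin 3) hp.le
    have h4 := mul_le_mul_of_nonneg_left (hcoin d) (inv_pos.2 hp).le
    rw [mul_assoc ((k : ℝ) + 1), mul_assoc ((k : ℝ) + 1)]
    refine mul_le_mul_of_nonneg_left ?_ (by positivity)
    linarith

end Counting

/-! ### The trace of a power as a sum over closed walks -/

section TraceExpansion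

variable {V : Type*} [DecidableEq V] [Fintype V]

/-- The endpoint weight `g` is arbitrary so that the induction can absorb the first step into it; `g
x y = A y x` later closes the walk. -/
lemma sum_path_prod_mul {R : Type*} [CommRing R] (A : Matrix V V R) (k : ℕ) (g : V → V → R) :
    ∑ w : Fin (k + 1) → V, (∏ i : Fin k, A (w i.castSucc) (w i.succ)) * g (w 0) (w (Fin.last k)) =
      ∑ x, ∑ y, (A ^ k) x y * g x y := by
  induction k generalizing g with
  | zero =>
    rw [← (Equiv.funUnique (Fin 1) V).symm.sum_comp]
    simp [Matrix.one_apply, Equiv.funUnique]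
  | succ k ih =>
    rw [← (Fin.consEquiv fun _ ↦ V).sum_comp, Fintype.sum_prod_type]
    refine Finset.sum_congr rfl fun x _ ↦ ?_
    have h := ih fun y z ↦ A x y * g x z
    simp only [Fin.consEquiv, Equiv.coe_fn_mk]
    calc _ = ∑ w : Fin (k + 1) → V, (∏ i : Fin k, A (w i.castSucc) (w i.succ)) *
          (A x (w 0) * g x (w (Fin.last k))) := by
          refine Finset.sum_congr rfl fun w _ ↦ ?_
          rw [Fin.prod_univ_succ, ← Fin.succ_last]
          simp only [Fin.castSucc_zero, Fin.cons_zero, Fin.cons_succ, ← Fin.succ_castSucc]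
          ring
      _ = _ := by
          rw [h, Finset.sum_comm]
          refine Finset.sum_congr rfl fun z _ ↦ ?_
          rw [pow_succ', Matrix.mul_apply, Finset.sum_mul]
          exact Finset.sum_congr rfl fun y _ ↦ by ring

lemma trace_pow_succ_eq_sum_closedWalk {R : Type*} [CommRing R] (A : Matrix V V R) (k : ℕ) :
    (A ^ (k + 1)).trace = ∑ w : Fin (k + 1) → V, ∏ i, A (w i) (w (i + 1)) := by
  have h := sum_path_prod_mul A k fun x y ↦ A y x
  rw [pow_succ, Matrix.trace]
  simp only [Matrix.diag_apply, Matrix.mul_apply]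
  rw [← h]
  refine Finset.sum_congr rfl fun w _ ↦ ?_
  rw [Fin.prod_univ_castSucc]
  simp

end TraceExpansion

/-! ### Covariances of square-free Bernoulli monomials -/

section BernoulliFamily

variable {ι Ω : Type*} [MeasurableSpace Ω] {P : Measure Ω}
  {p : unitInterval} {ξ : ι → Ω → ℝ}

lemma ae_eq_zero_or_one_of_hasLaw {X : Ω → ℝ} (h : HasLaw X (bernoulliMeasure (1 : ℝ) 0 p) P) :
    ∀ᵐ ω ∂P, X ω = 0 ∨ X ω = 1 := by
  have hm : MeasurableSet {x : ℝ | x = 0 ∨ x = 1} :=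
    (measurableSet_singleton (0 : ℝ)).union (measurableSet_singleton (1 : ℝ))
  refine (h.ae_iff (p := fun x ↦ x = 0 ∨ x = 1) (measurableSet_setOfPred.1 hm)).2 ?_
  rw [ae_iff]
  exact bernoulliMeasure_apply_of_notMem_of_notMem p hm.compl (by simp) (by simp)

lemma integral_of_hasLaw_bernoulli {X : Ω → ℝ} (h : HasLaw X (bernoulliMeasure (1 : ℝ) 0 p) P) :
    ∫ ω, X ω ∂P = p := by
  rw [h.integral_eq, integral_bernoulliMeasure]
  simp

lemma ae_forall_eq_zero_or_one [Finite ι]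
    (hlaw : ∀ e, HasLaw (ξ e) (bernoulliMeasure (1 : ℝ) 0 p) P) :
    ∀ᵐ ω ∂P, ∀ e, ξ e ω = 0 ∨ ξ e ω = 1 :=
  ae_all_iff.2 fun e ↦ ae_eq_zero_or_one_of_hasLaw (hlaw e)

variable [Fintype ι] [IsProbabilityMeasure P]

lemma memLp_monomial (hlaw : ∀ e, HasLaw (ξ e) (bernoulliMeasure (1 : ℝ) 0 p) P) (S : Finset ι) :
    MemLp (fun ω ↦ ∏ e ∈ S, ξ e ω) 2 P := by
  refine MemLp.of_bound (C := 1) ?_ ?_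
  · exact (Finset.aemeasurable_fun_prod _ fun e _ ↦ (hlaw e).aemeasurable).aestronglyMeasurable
  · filter_upwards [ae_forall_eq_zero_or_one hlaw] with ω h
    rw [Real.norm_eq_abs, Finset.abs_prod]
    refine Finset.prod_le_one (fun _ _ ↦ abs_nonneg _) fun e _ ↦ ?_
    rcases h e with h | h <;> simp [h]

lemma memLp_two_of_hasLaw (hlaw : ∀ e, HasLaw (ξ e) (bernoulliMeasure (1 : ℝ) 0 p) P) (e : ι) :
    MemLp (ξ e) 2 P := by
  simpa using memLp_monomial hlaw {e}

variable [DecidableEq ι]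

lemma prod_eq_prod_univ_ite {R : Type*} [CommMonoid R] (f : ι → R) (U : Finset ι) :
    ∏ e ∈ U, f e = ∏ e, if e ∈ U then f e else 1 := by
  rw [Finset.prod_ite_mem, Finset.univ_inter]

lemma integral_monomial (hlaw : ∀ e, HasLaw (ξ e) (bernoulliMeasure (1 : ℝ) 0 p) P)
    (hind : iIndepFun ξ P) (S : Finset ι) :
    ∫ ω, ∏ e ∈ S, ξ e ω ∂P = (p : ℝ) ^ S.card := by
  have h := hind.integral_fun_prod_comp (f := fun e x ↦ if e ∈ S then x else (1 : ℝ))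
    (fun e ↦ (hlaw e).aemeasurable)
    (fun e ↦ by by_cases he : e ∈ S <;> simp only [he, if_true, if_false] <;> fun_prop)
  have h2 : ∀ e, ∫ ω, (if e ∈ S then ξ e ω else 1) ∂P = if e ∈ S then (p : ℝ) else 1 := by
    intro e
    by_cases he : e ∈ S
    · simpa only [he, if_true] using integral_of_hasLaw_bernoulli (hlaw e)
    · simp [he]
  rw [integral_congr_ae (ae_of_all _ fun ω ↦ prod_eq_prod_univ_ite (fun e ↦ ξ e ω) S), h, Finset.prod_congr rfl fun e _ ↦ h2 e, ← prod_eq_prod_univ_ite (fun _ ↦ (p : ℝ)),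
    Finset.prod_const]

lemma covariance_monomial (hlaw : ∀ e, HasLaw (ξ e) (bernoulliMeasure (1 : ℝ) 0 p) P)
    (hind : iIndepFun ξ P) (S T : Finset ι) :
    cov[fun ω ↦ ∏ e ∈ S, ξ e ω, fun ω ↦ ∏ e ∈ T, ξ e ω; P] =
      (p : ℝ) ^ (S ∪ T).card - (p : ℝ) ^ (S.card + T.card) := by
  rw [covariance_eq_sub (memLp_monomial hlaw S) (memLp_monomial hlaw T),
    integral_monomial hlaw hind, integral_monomial hlaw hind, ← integral_monomial hlaw hind (S ∪ T),
    pow_add]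
  congr 1
  refine integral_congr_ae ?_
  filter_upwards [ae_forall_eq_zero_or_one hlaw] with ω h
  simp only [Pi.mul_apply]
  rw [prod_eq_prod_univ_ite _ S, prod_eq_prod_univ_ite _ T, prod_eq_prod_univ_ite _ (S ∪ T),
    ← Finset.prod_mul_distrib]
  refine Finset.prod_congr rfl fun e _ ↦ ?_
  by_cases h1 : e ∈ S <;> by_cases h2 : e ∈ T <;> rcases h e with h | h <;> simp [h1, h2, h]

lemma covariance_monomial_le (hlaw : ∀ e, HasLaw (ξ e) (bernoulliMeasure (1 : ℝ) 0 p) P)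
    (hind : iIndepFun ξ P) (S T : Finset ι) :
    cov[fun ω ↦ ∏ e ∈ S, ξ e ω, fun ω ↦ ∏ e ∈ T, ξ e ω; P] ≤
      (1 - p) * ((S ∩ T).card * (p : ℝ) ^ (S ∪ T).card) := by
  have hp0 : (0 : ℝ) ≤ p := p.2.1
  rw [covariance_monomial hlaw hind, ← Finset.card_union_add_card_inter, pow_add]
  -- Bernoulli's inequality gives `1 - p ^ s ≤ s * (1 - p)` for s common factors.
  have hb := one_add_mul_le_pow (a := (p : ℝ) - 1) (by linarith) (S ∩ T).card
  rw [add_sub_cancel] at hb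
  nlinarith [pow_nonneg hp0 (S ∪ T).card]

lemma covariance_monomial_singleton
    (hlaw : ∀ e, HasLaw (ξ e) (bernoulliMeasure (1 : ℝ) 0 p) P)
    (hind : iIndepFun ξ P) (S : Finset ι) (e : ι) :
    cov[fun ω ↦ ∏ e ∈ S, ξ e ω, ξ e; P] =
      if e ∈ S then (1 - p) * (p : ℝ) ^ S.card else 0 := by
  have h := covariance_monomial hlaw hind S {e}
  simp only [Finset.prod_singleton, Finset.card_singleton] at h
  rw [h, Finset.union_singleton]
  split_ifs with he
  · rw [Finset.insert_eq_of_mem he]; ring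
  · rw [Finset.card_insert_of_notMem he, sub_self]

lemma variance_sum_eq (hlaw : ∀ e, HasLaw (ξ e) (bernoulliMeasure (1 : ℝ) 0 p) P)
    (hind : iIndepFun ξ P) :
    Var[fun ω ↦ ∑ e, ξ e ω; P] = Fintype.card ι * ((1 - p) * p) := by
  rw [variance_fun_sum fun e ↦ memLp_two_of_hasLaw hlaw e]
  have h : ∀ e e', cov[ξ e, ξ e'; P] = if e' ∈ ({e} : Finset ι) then (1 - p) * (p : ℝ) else 0 := by
    intro e e'
    simpa using covariance_monomial_singleton hlaw hind {e} e'
  simp [h]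

/-- The ratio of successive terms is `(b + 1) * p / b`, at most 1 for `b ≥ 1` and `p ≤ 1 / 2`. -/
lemma mul_pow_antitone {p : ℝ} (hp0 : 0 ≤ p) (hp : p ≤ 1 / 2) {a b : ℕ} (ha : 0 < a)
    (hab : a ≤ b) : b * p ^ b ≤ a * p ^ a := by
  induction b, hab using Nat.le_induction with
  | base => exact le_rfl
  | succ b hb ih =>
    refine le_trans ?_ ih
    have hb1 : (1 : ℝ) ≤ b := by exact_mod_cast (by omega : 1 ≤ b)
    rw [pow_succ]
    push_cast
    have := pow_nonneg hp0 b
    have h2 : ((b : ℝ) + 1) * p ≤ b := by nlinarith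
    nlinarith

/-- The second moment of the part of a sum of square-free monomials that is not linear. -/
lemma variance_sum_monomial_sub_le {W : Type*} [Fintype W] (E : W → Finset ι) {N : ℕ}
    (hE0 : ∀ w, 0 < (E w).card) (hEN : ∀ w, (E w).card ≤ N)
    (hlaw : ∀ e, HasLaw (ξ e) (bernoulliMeasure (1 : ℝ) 0 p) P)
    (hind : iIndepFun ξ P) (hp : (p : ℝ) ≤ 1 / 2) {c : ℝ} (hc : 0 ≤ c) :
    Var[fun ω ↦ (∑ w, ∏ e ∈ E w, ξ e ω) - c * ∑ e, ξ e ω; P] ≤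
      (1 - p) * ((∑ w, ∑ w', ((E w ∩ E w').card : ℝ) * (p : ℝ) ^ (E w ∪ E w').card) -
        2 * c * (Fintype.card W * (N * (p : ℝ) ^ N)) + c ^ 2 * (Fintype.card ι * p)) := by
  have hp0 : (0 : ℝ) ≤ p := p.2.1
  have hq : (0 : ℝ) ≤ 1 - p := by linarith
  have hF : MemLp (fun ω ↦ ∑ w, ∏ e ∈ E w, ξ e ω) 2 P :=
    memLp_finsetSum _ fun w _ ↦ memLp_monomial hlaw (E w)
  have hL : MemLp (fun ω ↦ ∑ e, ξ e ω) 2 P :=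
    memLp_finsetSum _ fun e _ ↦ memLp_two_of_hasLaw hlaw e
  rw [variance_fun_sub hF (hL.const_mul c), variance_const_mul, covariance_const_mul_right,
    variance_sum_eq hlaw hind, variance_fun_sum fun w ↦ memLp_monomial hlaw (E w),
    covariance_fun_sum_fun_sum (fun w ↦ memLp_monomial hlaw (E w))
      fun e ↦ memLp_two_of_hasLaw hlaw e]
  have h1 : ∑ w, ∑ w', cov[fun ω ↦ ∏ e ∈ E w, ξ e ω, fun ω ↦ ∏ e ∈ E w', ξ e ω; P] ≤
      (1 - p) * ∑ w, ∑ w', ((E w ∩ E w').card : ℝ) * (p : ℝ) ^ (E w ∪ E w').card := by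
    simp only [Finset.mul_sum]
    exact Finset.sum_le_sum fun w _ ↦ Finset.sum_le_sum fun w' _ ↦
      covariance_monomial_le hlaw hind _ _
  have h2 : (1 - (p : ℝ)) * (Fintype.card W * (N * (p : ℝ) ^ N)) ≤
      ∑ w, ∑ e, cov[fun ω ↦ ∏ e ∈ E w, ξ e ω, ξ e; P] := by
    have h3 : ∀ w, (1 - (p : ℝ)) * (N * (p : ℝ) ^ N) ≤
        ∑ e, cov[fun ω ↦ ∏ e ∈ E w, ξ e ω, ξ e; P] := by
      intro w
      simp only [covariance_monomial_singleton hlaw hind]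
      rw [Finset.sum_ite_mem, Finset.univ_inter, Finset.sum_const, nsmul_eq_mul]
      have := mul_le_mul_of_nonneg_left (mul_pow_antitone hp0 hp (hE0 w) (hEN w)) hq
      linarith
    calc _ = ∑ _w : W, (1 - (p : ℝ)) * (N * (p : ℝ) ^ N) := by
          rw [Finset.sum_const, Finset.card_univ, nsmul_eq_mul]; ring
      _ ≤ _ := Finset.sum_le_sum fun w _ ↦ h3 w
  have h4 := mul_le_mul_of_nonneg_left h2 hc
  nlinarith

end BernoulliFamily

/-! ### Entries of the symmetric matrix indexed by unordered pairs -/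

section Matrix

variable {Ω : Type*} [MeasurableSpace Ω] {P : Measure Ω} {n : ℕ}
  {p : unitInterval} {A : Ω → Matrix (Fin n) (Fin n) ℝ}

/-- The entry of a symmetric matrix at an unordered pair of indices. -/
def symmEntry (A : Ω → Matrix (Fin n) (Fin n) ℝ) (e : Sym2 (Fin n)) (ω : Ω) : ℝ :=
  A ω (Sym2.sortEquiv e).1.1 (Sym2.sortEquiv e).1.2

namespace IsSymmBernoulliMatrix

lemma apply_eq_symmEntry (hA : IsSymmBernoulliMatrix P p A) (ω : Ω) (i j : Fin n) :
    A ω i j = symmEntry A s(i, j) ω := by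
  simp only [symmEntry, Sym2.sortEquiv, Equiv.coe_fn_mk, Sym2.inf_mk, Sym2.sup_mk]
  rcases le_total i j with h | h
  · simp [h]
  · simp [h, (hA.isSymm ω).apply i j]

lemma hasLaw_symmEntry (hA : IsSymmBernoulliMatrix P p A) (e : Sym2 (Fin n)) :
    HasLaw (symmEntry A e) (bernoulliMeasure (1 : ℝ) 0 p) P :=
  hA.hasLaw _ _ (Sym2.sortEquiv e).2

lemma iIndepFun_symmEntry (hA : IsSymmBernoulliMatrix P p A) :
    ProbabilityTheory.iIndepFun (symmEntry A) P := by
  have h := hA.iIndepFun.precomp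
    (g := (Sym2.sortEquiv : Sym2 (Fin n) ≃ {e : Fin n × Fin n // e.1 ≤ e.2}))
    Sym2.sortEquiv.injective
  exact h

/-- Almost surely the entries are idempotent, so the multiplicity with which a walk uses an edge is
irrelevant. -/
lemma trace_pow_ae_eq (hA : IsSymmBernoulliMatrix P p A) (k : ℕ) :
    (fun ω ↦ (A ω ^ (k + 1)).trace) =ᵐ[P] fun ω ↦
      ∑ w : Fin (k + 1) → Fin n, ∏ e ∈ closedWalkEdges w, symmEntry A e ω := by
  filter_upwards [ae_forall_eq_zero_or_one hA.hasLaw_symmEntry] with ω h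
  rw [trace_pow_succ_eq_sum_closedWalk]
  refine Finset.sum_congr rfl fun w _ ↦ ?_
  simp only [hA.apply_eq_symmEntry ω]
  have hidem : ∀ e, ∀ c : ℕ, c ≠ 0 → symmEntry A e ω ^ c = symmEntry A e ω := by
    intro e c hc
    rcases h e with h | h <;> simp [h, hc]
  rw [closedWalkEdges, ← Finset.prod_fiberwise_of_maps_to (s := Finset.univ)
    (g := fun i ↦ s(w i, w (i + 1))) fun i hi ↦ Finset.mem_image_of_mem
      (fun i ↦ s(w i, w (i + 1))) hi]
  refine Finset.prod_congr rfl fun e he ↦ ?_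
  obtain ⟨i, -, hi⟩ := Finset.mem_image.1 he
  rw [Finset.prod_congr rfl fun j hj ↦ by rw [(Finset.mem_filter.1 hj).2], Finset.prod_const]
  exact hidem e _ (Finset.card_ne_zero_of_mem (Finset.mem_filter.2 ⟨Finset.mem_univ i, hi⟩))

end IsSymmBernoulliMatrix

end Matrix

/-! ### Characteristic function estimates -/

section CharacteristicFunction

lemma norm_pow_sub_pow_le_mul {z w : ℂ} (hz : ‖z‖ ≤ 1) (hw : ‖w‖ ≤ 1) (M : ℕ) :
    ‖z ^ M - w ^ M‖ ≤ M * ‖z - w‖ := by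
  induction M with
  | zero => simp
  | succ M ih =>
    have h : z ^ (M + 1) - w ^ (M + 1) = z * (z ^ M - w ^ M) + (z - w) * w ^ M := by ring
    rw [h]
    refine (norm_add_le _ _).trans ?_
    rw [norm_mul, norm_mul, norm_pow]
    have h1 : ‖z‖ * ‖z ^ M - w ^ M‖ ≤ 1 * (M * ‖z - w‖) :=
      mul_le_mul hz ih (norm_nonneg _) zero_le_one
    have h2 : ‖z - w‖ * ‖w‖ ^ M ≤ ‖z - w‖ * 1 :=
      mul_le_mul_of_nonneg_left (pow_le_one₀ (norm_nonneg _) hw) (norm_nonneg _)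
    push_cast
    linarith

lemma norm_exp_mul_I_sub_taylor_le (x : ℝ) :
    ‖Complex.exp (x * Complex.I) - (1 + x * Complex.I - x ^ 2 / 2)‖ ≤
      |x| ^ 3 * Real.exp |x| := by
  have h := Complex.norm_exp_sub_sum_le_norm_mul_exp (x * Complex.I) 3
  have hn : ‖(x : ℂ) * Complex.I‖ = |x| := by simp
  rw [hn] at h
  convert h using 3
  simp only [Finset.sum_range_succ, Finset.sum_range_zero, Nat.factorial]
  rw [mul_pow (x : ℂ) Complex.I 2, Complex.I_sq]
  push_cast
  ring

/-- The characteristic function of a centered Bernoulli variable against a Gaussian one. -/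
lemma norm_centered_bernoulli_charFun_sub_exp_le {p : ℝ} (hp0 : 0 ≤ p) (hp1 : p ≤ 1) (b : ℝ) :
    ‖(p : ℂ) * Complex.exp ((b * (1 - p) : ℝ) * Complex.I) +
        ((1 - p : ℝ) : ℂ) * Complex.exp ((b * (0 - p) : ℝ) * Complex.I) -
        Complex.exp ((-(b ^ 2 * (p * (1 - p)) / 2) : ℝ))‖ ≤
      b ^ 2 * (p * (1 - p)) * ((|b| + b ^ 2) * Real.exp (|b| + b ^ 2)) := by
  have hq0 : 0 ≤ 1 - p := by linarith
  set τ := b ^ 2 * (p * (1 - p)) with hτ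
  have hpq : p * (1 - p) ≤ 1 := by nlinarith
  have hpq0 : 0 ≤ p * (1 - p) := by positivity
  have hτ0 : 0 ≤ τ := by positivity
  have hτb : τ ≤ b ^ 2 := by nlinarith [sq_nonneg b]
  have h1 := norm_exp_mul_I_sub_taylor_le (b * (1 - p))
  have h2 := norm_exp_mul_I_sub_taylor_le (b * (0 - p))
  have h3 := Complex.norm_exp_sub_sum_le_norm_mul_exp ((-(τ / 2) : ℝ) : ℂ) 2
  have e1 : |b * (1 - p)| = |b| * (1 - p) := by rw [abs_mul, abs_of_nonneg hq0]
  have e2 : |b * (0 - p)| = |b| * p := by rw [abs_mul, zero_sub, abs_neg, abs_of_nonneg hp0]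
  have e3 : ‖((-(τ / 2) : ℝ) : ℂ)‖ = τ / 2 := by
    rw [Complex.norm_real, Real.norm_eq_abs, abs_neg, abs_of_nonneg (by positivity)]
  rw [e1] at h1
  rw [e2] at h2
  rw [e3] at h3
  set T1 := Complex.exp ((b * (1 - p) : ℝ) * Complex.I)
  set T2 := Complex.exp ((b * (0 - p) : ℝ) * Complex.I)
  set T3 := Complex.exp ((-(τ / 2) : ℝ))
  -- The Taylor polynomials cancel: the centered Bernoulli variable and the Gaussian share mean 0
  -- and variance `p * (1 - p)`.
  have hdec : (p : ℂ) * T1 + ((1 - p : ℝ) : ℂ) * T2 - T3 =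
      (p : ℂ) * (T1 - (1 + (b * (1 - p) : ℝ) * Complex.I - (b * (1 - p) : ℝ) ^ 2 / 2)) +
      ((1 - p : ℝ) : ℂ) * (T2 - (1 + (b * (0 - p) : ℝ) * Complex.I - (b * (0 - p) : ℝ) ^ 2 / 2)) -
      (T3 - ∑ m ∈ Finset.range 2, ((-(τ / 2) : ℝ) : ℂ) ^ m / m.factorial) := by
    simp only [Finset.sum_range_succ, Finset.sum_range_zero, Nat.factorial, hτ]
    push_cast
    ring
  rw [hdec]
  have hexp : ∀ y, y ≤ |b| + b ^ 2 → Real.exp y ≤ Real.exp (|b| + b ^ 2) := fun y hy ↦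
    Real.exp_le_exp.2 hy
  have hb0 := abs_nonneg b
  have hb2 : |b| ^ 2 = b ^ 2 := sq_abs b
  set Z := Real.exp (|b| + b ^ 2)
  have hZ : 0 < Z := Real.exp_pos _
  have g1 : (|b| * (1 - p)) ^ 3 * Real.exp (|b| * (1 - p)) ≤ (|b| * (1 - p)) ^ 3 * Z :=
    mul_le_mul_of_nonneg_left (hexp _ (by nlinarith [sq_nonneg b])) (by positivity)
  have g2 : (|b| * p) ^ 3 * Real.exp (|b| * p) ≤ (|b| * p) ^ 3 * Z :=
    mul_le_mul_of_nonneg_left (hexp _ (by nlinarith [sq_nonneg b])) (by positivity)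
  have g3 : (τ / 2) ^ 2 * Real.exp (τ / 2) ≤ (τ / 2) ^ 2 * Z :=
    mul_le_mul_of_nonneg_left (hexp _ (by linarith)) (by positivity)
  have n1 := mul_le_mul_of_nonneg_left (h1.trans g1) hp0
  have n2 := mul_le_mul_of_nonneg_left (h2.trans g2) hq0
  have n3 := h3.trans g3
  refine (norm_sub_le _ _).trans ((add_le_add_left (norm_add_le _ _) _).trans ?_)
  rw [norm_mul, norm_mul, Complex.norm_real, Complex.norm_real, Real.norm_of_nonneg hp0,
    Real.norm_of_nonneg hq0]
  refine (add_le_add (add_le_add n1 n2) n3).trans ?_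
  have k1 : p * (|b| * (1 - p)) ^ 3 + (1 - p) * (|b| * p) ^ 3 ≤ τ * |b| := by
    have : p * (|b| * (1 - p)) ^ 3 + (1 - p) * (|b| * p) ^ 3 =
        (|b| ^ 2 * (p * (1 - p)) * |b|) * ((1 - p) ^ 2 + p ^ 2) := by ring
    rw [this, hb2]
    have h5 : (1 - p) ^ 2 + p ^ 2 ≤ 1 := by nlinarith
    have h6 : 0 ≤ τ * |b| := by positivity
    nlinarith
  have k2 : (τ / 2) ^ 2 ≤ τ * b ^ 2 := by nlinarith
  have k3 := mul_le_mul_of_nonneg_right (add_le_add k1 k2) hZ.le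
  linarith

/-- This transfers the limit between variables that merge in L²: `x ↦ exp (itx)` is `|t|`-Lipschitz,
and the L¹ norm is at most the L² norm. -/
lemma norm_charFun_map_sub_le {Ω : Type*} [MeasurableSpace Ω] {P : Measure Ω}
    [IsProbabilityMeasure P] {X Y : Ω → ℝ} (hX : MemLp X 2 P) (hY : MemLp Y 2 P) (t : ℝ) :
    ‖charFun (P.map X) t - charFun (P.map Y) t‖ ≤ |t| * √(∫ ω, (X ω - Y ω) ^ 2 ∂P) := by
  have hmX := hX.aestronglyMeasurable.aemeasurable
  have hmY := hY.aestronglyMeasurable.aemeasurable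
  have hcont : Continuous fun x : ℝ ↦ Complex.exp (t * x * Complex.I) := by fun_prop
  have hintegrable : ∀ {Z : Ω → ℝ}, AEMeasurable Z P →
      Integrable (fun ω ↦ Complex.exp (t * (Z ω : ℝ) * Complex.I)) P := by
    intro Z hZ
    refine Integrable.of_bound (C := 1) ?_ (ae_of_all _ fun ω ↦ ?_)
    · exact (hcont.measurable.comp_aemeasurable hZ).aestronglyMeasurable
    · rw [← Complex.ofReal_mul, Complex.norm_exp_ofReal_mul_I]
  rw [charFun_apply_real, charFun_apply_real,
    integral_map hmX hcont.aestronglyMeasurable,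
    integral_map hmY hcont.aestronglyMeasurable, ← integral_sub (hintegrable hmX) (hintegrable hmY)]
  have hD : MemLp (fun ω ↦ X ω - Y ω) 2 P := hX.sub hY
  have hDi : Integrable (fun ω ↦ |X ω - Y ω|) P := (hD.integrable (by norm_num)).abs
  have hpt : ∀ ω, ‖Complex.exp (t * (X ω : ℝ) * Complex.I) -
      Complex.exp (t * (Y ω : ℝ) * Complex.I)‖ ≤ |t| * |X ω - Y ω| := by
    intro ω
    have h1 : Complex.exp (t * (X ω : ℝ) * Complex.I) - Complex.exp (t * (Y ω : ℝ) * Complex.I) =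
        Complex.exp ((t * Y ω : ℝ) * Complex.I) *
          (Complex.exp (Complex.I * (t * (X ω - Y ω) : ℝ)) - 1) := by
      rw [mul_sub, ← Complex.exp_add, mul_one]
      push_cast
      congr 2
      · ring
    rw [h1, norm_mul, Complex.norm_exp_ofReal_mul_I, one_mul, ← abs_mul]
    exact Real.norm_exp_I_mul_ofReal_sub_one_le
  calc _ ≤ ∫ ω, |t| * |X ω - Y ω| ∂P :=
        norm_integral_le_of_norm_le (hDi.const_mul _) (ae_of_all _ hpt)
    _ = |t| * ∫ ω, |X ω - Y ω| ∂P := integral_const_mul _ _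
    _ ≤ _ := by
        refine mul_le_mul_of_nonneg_left (Real.le_sqrt_of_sq_le ?_) (abs_nonneg t)
        have hDa : MemLp (fun ω ↦ |X ω - Y ω|) 2 P := hD.abs
        -- Nonnegativity of the variance of `|X - Y|` is the Cauchy–Schwarz inequality needed here.
        have hv := variance_nonneg (fun ω ↦ |X ω - Y ω|) P
        rw [variance_eq_sub hDa] at hv
        have h5 : P[(fun ω ↦ |X ω - Y ω|) ^ 2] = ∫ ω, (X ω - Y ω) ^ 2 ∂P := by
          simp only [Pi.pow_apply, sq_abs]
        rw [h5] at hv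
        linarith

/-- The characteristic function of a scaled and centered sum of independent Bernoulli variables. -/
lemma norm_charFun_sum_bernoulli_sub_le {ι Ω : Type*} [Fintype ι] [MeasurableSpace Ω]
    {P : Measure Ω} [IsProbabilityMeasure P] {p : unitInterval} {ξ : ι → Ω → ℝ}
    (hlaw : ∀ e, HasLaw (ξ e) (bernoulliMeasure (1 : ℝ) 0 p) P) (hind : iIndepFun ξ P)
    (a t : ℝ) :
    ‖charFun (P.map fun ω ↦ ∑ e, a * (ξ e ω - p)) t -
        Complex.exp ((-(Fintype.card ι * ((t * a) ^ 2 * (p * (1 - p))) / 2) : ℝ))‖ ≤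
      Fintype.card ι * ((t * a) ^ 2 * (p * (1 - p)) *
        ((|t * a| + (t * a) ^ 2) * Real.exp (|t * a| + (t * a) ^ 2))) := by
  have hp0 : (0 : ℝ) ≤ p := p.2.1
  have hp1 : (p : ℝ) ≤ 1 := p.2.2
  have hg : Measurable fun x : ℝ ↦ a * (x - p) := by fun_prop
  have hmeas : ∀ e, AEMeasurable (fun ω ↦ a * (ξ e ω - p)) P := fun e ↦
    hg.comp_aemeasurable (hlaw e).aemeasurable
  have hind' : iIndepFun (fun e ω ↦ a * (ξ e ω - p)) P :=
    hind.comp (fun _ x ↦ a * (x - p)) fun _ ↦ hg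
  set b := t * a with hb
  set z : ℂ := (((p : ℝ) : ℂ) * Complex.exp ((b * (1 - p) : ℝ) * Complex.I) +
        ((1 - p : ℝ) : ℂ) * Complex.exp ((b * (0 - p) : ℝ) * Complex.I)) with hz
  have hone : ∀ e, charFun (P.map fun ω ↦ a * (ξ e ω - p)) t = z := by
    intro e
    have hcont : Continuous fun x : ℝ ↦ Complex.exp (t * x * Complex.I) := by fun_prop
    have hcont2 : Continuous fun x : ℝ ↦
        Complex.exp (t * (a * (x - p) : ℝ) * Complex.I) := by fun_prop
    rw [charFun_apply_real, integral_map (hmeas e) hcont.aestronglyMeasurable]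
    have h := (hlaw e).integral_comp
      (f := fun x : ℝ ↦ Complex.exp (t * (a * (x - p) : ℝ) * Complex.I))
      hcont2.aestronglyMeasurable
    rw [integral_bernoulliMeasure] at h
    refine h.trans ?_
    rw [hz, hb]
    simp only [Complex.real_smul]
    push_cast
    congr 3 <;> · congr 1; ring
  rw [hind'.charFun_map_fun_sum_eq_prod hmeas, Finset.prod_apply,
    Finset.prod_congr rfl fun e _ ↦ hone e, Finset.prod_const, Finset.card_univ]
  have hexp : Complex.exp ((-(Fintype.card ι * (b ^ 2 * (p * (1 - p))) / 2) : ℝ)) =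
      Complex.exp ((-(b ^ 2 * (p * (1 - p)) / 2) : ℝ)) ^ Fintype.card ι := by
    rw [← Complex.exp_nat_mul]
    congr 1
    push_cast
    ring
  rw [hexp]
  have hz1 : ‖z‖ ≤ 1 := by
    refine (norm_add_le _ _).trans ?_
    rw [norm_mul, norm_mul, Complex.norm_exp_ofReal_mul_I, Complex.norm_exp_ofReal_mul_I,
      Complex.norm_real, Complex.norm_real, Real.norm_of_nonneg hp0,
      Real.norm_of_nonneg (by linarith)]
    linarith
  have hw1 : ‖Complex.exp ((-(b ^ 2 * (p * (1 - p)) / 2) : ℝ))‖ ≤ 1 := by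
    rw [Complex.norm_exp, Complex.ofReal_re, Real.exp_le_one_iff]
    have : 0 ≤ b ^ 2 * ((p : ℝ) * (1 - p)) := by
      have : (0 : ℝ) ≤ 1 - p := by linarith
      positivity
    linarith
  refine (norm_pow_sub_pow_le_mul hz1 hw1 _).trans
    (mul_le_mul_of_nonneg_left ?_ (Nat.cast_nonneg _))
  exact norm_centered_bernoulli_charFun_sub_exp_le hp0 hp1 b

end CharacteristicFunction

lemma card_sym2_fin (n : ℕ) : (Fintype.card (Sym2 (Fin n)) : ℝ) = n * (n + 1) / 2 := by
  rw [Sym2.card, Fintype.card_fin, Nat.cast_choose_two]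
  push_cast
  ring

/-! ### L² comparison of the trace with its linear part -/

namespace IsSymmBernoulliMatrix

variable {Ω : Type*} [MeasurableSpace Ω] {P : Measure Ω} [IsProbabilityMeasure P] {n : ℕ}
  {p : unitInterval} {A : Ω → Matrix (Fin n) (Fin n) ℝ}

lemma memLp_trace_pow (hA : IsSymmBernoulliMatrix P p A) (k : ℕ) :
    MemLp (fun ω ↦ (A ω ^ k).trace) 2 P := by
  cases k with
  | zero => simpa using memLp_const (n : ℝ)
  | succ k =>
    refine (memLp_congr_ae (hA.trace_pow_ae_eq k)).2 ?_
    exact memLp_finsetSum _ fun w _ ↦ memLp_monomial hA.hasLaw_symmEntry _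

lemma memLp_normalizedTrace (hA : IsSymmBernoulliMatrix P p A) (r : ℝ) (m : ℕ) :
    MemLp (normalizedTrace P r m A) 2 P := by
  have h := ((hA.memLp_trace_pow (2 * m)).sub
    (memLp_const (∫ ω', (A ω' ^ (2 * m)).trace ∂P))).const_mul
    (2 * (m : ℝ) * ((n : ℝ) * r) ^ (2 * m - 1) * √(r * (1 - r)))⁻¹
  refine (memLp_congr_ae (ae_of_all _ fun ω ↦ ?_)).1 h
  simp only [normalizedTrace, Pi.sub_apply]
  rw [div_eq_inv_mul]

lemma memLp_linear (hA : IsSymmBernoulliMatrix P p A) (a : ℝ) :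
    MemLp (fun ω ↦ ∑ e, a * (symmEntry A e ω - p)) 2 P :=
  memLp_finsetSum _ fun e _ ↦
    ((memLp_two_of_hasLaw hA.hasLaw_symmEntry e).sub (memLp_const (p : ℝ))).const_mul a

/-- The variance of the nonlinear part of the trace. -/
lemma variance_sum_closedWalk_sub_le (hA : IsSymmBernoulliMatrix P p A) {k : ℕ} (hk : 2 ≤ k)
    (hn : 0 < n) (hp0 : 0 < (p : ℝ)) (hp : (p : ℝ) ≤ 1 / 2)
    (hθ : ((2 * (k + 1) : ℕ) : ℝ) ^ 2 ≤ n * p) (d : ℕ) (hd : 4 * d ≤ k + 1 + 3) :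
    Var[fun ω ↦ (∑ w : Fin (k + 1) → Fin n, ∏ e ∈ closedWalkEdges w, symmEntry A e ω) -
        (k + 1) * (n * p) ^ k * 2 / n * ∑ e, symmEntry A e ω; P] ≤
      ((k + 1) * (n * p) ^ k) ^ 2 * (p * (1 - p)) *
        (2 / n + 3 * (((2 * (k + 1) : ℕ) : ℝ) ^ 6 / (n * p) +
          n ^ 2 * (((2 * (k + 1) : ℕ) : ℝ) ^ 2 / (n * p)) ^ d)) := by
  have hq : (0 : ℝ) < 1 - p := by linarith
  have hnr : (0 : ℝ) < n := by exact_mod_cast hn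
  have hB := sum_card_inter_mul_pow_le (V := Fin n) hk hp0 (by linarith) d hd
    (by rw [Fintype.card_fin]; exact hθ)
  have hc0 : (0 : ℝ) ≤ (k + 1) * (n * p) ^ k * 2 / n := by positivity
  have hV := variance_sum_monomial_sub_le (fun w : Fin (k + 1) → Fin n ↦ closedWalkEdges w)
    (N := k + 1) card_closedWalkEdges_pos card_closedWalkEdges_le hA.hasLaw_symmEntry
    hA.iIndepFun_symmEntry hp hc0
  refine hV.trans ?_
  rw [Fintype.card_fin] at hB
  have hcardW : (Fintype.card (Fin (k + 1) → Fin n) : ℝ) = (n : ℝ) ^ (k + 1) := by simp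
  rw [hcardW, card_sym2_fin]
  generalize (∑ w : Fin (k + 1) → Fin n, ∑ w' : Fin (k + 1) → Fin n,
    ((closedWalkEdges w ∩ closedWalkEdges w').card : ℝ) *
      (p : ℝ) ^ (closedWalkEdges w ∪ closedWalkEdges w').card) = B at hB ⊢
  have e1 : 2 * (k + 1) - 2 = 2 * k := by omega
  have e2 : 2 * (k + 1) - 1 = 2 * k + 1 := by omega
  rw [e1, e2] at hB
  generalize (((2 * (k + 1) : ℕ) : ℝ)) = K at hB ⊢
  generalize hr : (p : ℝ) = r at *
  have hN1 : (1 : ℝ) ≤ k + 1 := by linarith [(Nat.cast_nonneg k : (0 : ℝ) ≤ k)]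
  have t0 : (((k + 1 : ℕ) : ℝ)) = k + 1 := by push_cast; ring
  rw [t0]
  generalize (k : ℝ) + 1 = N at *
  have t1 : 2 * N ^ 2 * (n : ℝ) ^ (2 * k) * r ^ (2 * k + 1) =
      2 * (N * (n * r) ^ k) ^ 2 * r := by
    rw [mul_pow N, ← pow_mul, mul_comm k 2, mul_pow (n : ℝ)]; ring
  have t2 : (n * r) ^ (2 * (k + 1)) = (n * r) ^ 2 * ((n * r) ^ k) ^ 2 := by ring
  have t3 : (n : ℝ) ^ (k + 1) * (N * r ^ (k + 1)) = N * ((n * r) ^ k * (n * r)) := by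
    rw [← pow_succ, mul_pow]; ring
  rw [t1, t2] at hB
  rw [t3]
  have hu0 : 0 < (n * r) ^ k := by positivity
  generalize ((n : ℝ) * r) ^ k = u at *
  have hx0 : 0 < n * r := by positivity
  have hy0 : 0 ≤ (K ^ 2 / (n * r)) ^ d := by positivity
  generalize (K ^ 2 / (n * r)) ^ d = y at *
  -- With `t1`, the main terms are 2, -4 and 2 in units of `(N * u) ^ 2 * r`. The surplus `2 / n` in
  -- `t5` comes from the diagonal: there are `n * (n + 1) / 2` entries, not `n ^ 2 / 2`.
  have t4 : 2 * (N * u * 2 / n) * (N * (u * (n * r))) = 4 * (N * u) ^ 2 * r := by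
    field_simp; ring
  have t5 : (N * u * 2 / n) ^ 2 * ((n : ℝ) * (n + 1) / 2 * r) =
      (N * u) ^ 2 * r * (2 + 2 / n) := by
    field_simp
  rw [t4, t5]
  have hrest : N * 3 * ((n * r) ^ 2 * u ^ 2) * (r * (K ^ 2 / (n * r)) ^ 3 + r⁻¹ * y) ≤
      (N * u) ^ 2 * r * (3 * (K ^ 6 / (n * r) + n ^ 2 * y)) := by
    have h1 : N * 3 * ((n * r) ^ 2 * u ^ 2) * (r * (K ^ 2 / (n * r)) ^ 3 + r⁻¹ * y) =
        1 * (N * (u ^ 2 * r * (3 * (K ^ 6 / (n * r) + n ^ 2 * y)))) := by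
      field_simp
    have h2 : 0 ≤ N * (u ^ 2 * r * (3 * (K ^ 6 / (n * r) + n ^ 2 * y))) := by positivity
    rw [h1]
    refine (mul_le_mul_of_nonneg_right hN1 h2).trans (le_of_eq (by ring))
  have hfin : B - 4 * (N * u) ^ 2 * r + (N * u) ^ 2 * r * (2 + 2 / n) ≤
      (N * u) ^ 2 * r * (2 / n + 3 * (K ^ 6 / (n * r) + n ^ 2 * y)) := by
    have h3 := hB.trans (add_le_add_right hrest _)
    have h4 : (N * u) ^ 2 * r * (2 / n + 3 * (K ^ 6 / (n * r) + n ^ 2 * y)) =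
      (2 * (N * u) ^ 2 * r + (N * u) ^ 2 * r * (3 * (K ^ 6 / (n * r) + n ^ 2 * y))) -
        4 * (N * u) ^ 2 * r + (N * u) ^ 2 * r * (2 + 2 / n) := by ring
    rw [h4]
    exact add_le_add_left (sub_le_sub_right h3 _) _
  exact (mul_le_mul_of_nonneg_left hfin hq.le).trans (le_of_eq (by ring))

/-- The normalized trace minus a linear function of the entries, up to centering and scaling. -/
lemma integral_normalizedTrace_sub_sq_eq (hA : IsSymmBernoulliMatrix P p A) {m k : ℕ}
    (hk : 2 * m = k + 1) (hn : 0 < n) (hp0 : 0 < (p : ℝ)) (hp1 : (p : ℝ) < 1) :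
    ∫ ω, (normalizedTrace P p m A ω -
        ∑ e, 2 / (n * √(p * (1 - p))) * (symmEntry A e ω - p)) ^ 2 ∂P =
      Var[fun ω ↦ (∑ w : Fin (k + 1) → Fin n, ∏ e ∈ closedWalkEdges w, symmEntry A e ω) -
        (k + 1) * (n * p) ^ k * 2 / n * ∑ e, symmEntry A e ω; P] /
      (((k + 1) * (n * p) ^ k) ^ 2 * (p * (1 - p))) := by
  have hq : (0 : ℝ) < 1 - p := by linarith
  have hnr : (0 : ℝ) < n := by exact_mod_cast hn
  have hN : (2 * (m : ℝ)) = k + 1 := by exact_mod_cast hk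
  have hs0 : 0 < √((p : ℝ) * (1 - p)) := Real.sqrt_pos.2 (by positivity)
  have hs2 : √((p : ℝ) * (1 - p)) ^ 2 = p * (1 - p) := Real.sq_sqrt (by positivity)
  have hlaw := hA.hasLaw_symmEntry
  have hF : MemLp (fun ω ↦ ∑ w : Fin (k + 1) → Fin n,
      ∏ e ∈ closedWalkEdges w, symmEntry A e ω) 2 P :=
    memLp_finsetSum _ fun w _ ↦ memLp_monomial hlaw _
  have hL : MemLp (fun ω ↦ ∑ e, symmEntry A e ω) 2 P :=
    memLp_finsetSum _ fun e _ ↦ memLp_two_of_hasLaw hlaw e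
  -- Divided by the normalization `(k + 1) * (n * p) ^ k * √(p * (1 - p))`, this is the coefficient
  -- `2 / (n * √(p * (1 - p)))` of the linear statistic.
  set c : ℝ := (k + 1) * (n * p) ^ k * 2 / n with hc
  have hGm : MemLp (fun ω ↦ (∑ w : Fin (k + 1) → Fin n, ∏ e ∈ closedWalkEdges w,
      symmEntry A e ω) - c * ∑ e, symmEntry A e ω) 2 P := hF.sub (hL.const_mul c)
  have htr : ∫ ω, (A ω ^ (k + 1)).trace ∂P = ∫ ω, ∑ w : Fin (k + 1) → Fin n,
      ∏ e ∈ closedWalkEdges w, symmEntry A e ω ∂P := integral_congr_ae (hA.trace_pow_ae_eq k)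
  have hLint : ∫ ω, ∑ e, symmEntry A e ω ∂P = Fintype.card (Sym2 (Fin n)) * p := by
    rw [integral_finsetSum _ fun e _ ↦ (memLp_two_of_hasLaw hlaw e).integrable (by norm_num)]
    simp only [integral_of_hasLaw_bernoulli (hlaw _), Finset.sum_const, Finset.card_univ,
      nsmul_eq_mul]
  rw [variance_eq_integral hGm.aestronglyMeasurable.aemeasurable, ← integral_div]
  refine integral_congr_ae ?_
  rw [integral_sub (hF.integrable (by norm_num))
    ((hL.integrable (by norm_num)).const_mul c), integral_const_mul, hLint, ← htr]
  filter_upwards [hA.trace_pow_ae_eq k] with ω hω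
  have hD : (((k : ℝ) + 1) * (n * p) ^ k) ^ 2 * (p * (1 - p)) =
      ((k + 1) * (n * p) ^ k * √((p : ℝ) * (1 - p))) ^ 2 := by rw [mul_pow _ √_, hs2]
  rw [hD, ← div_pow]
  congr 1
  simp only [normalizedTrace, hk, Nat.add_sub_cancel]
  rw [hω, hN, ← Finset.mul_sum, Finset.sum_sub_distrib, Finset.sum_const,
    Finset.card_univ, nsmul_eq_mul, hc]
  field_simp
  ring

/-- The normalized trace is close in `L²` to a linear function of the entries. -/
lemma integral_normalizedTrace_sub_sq_le (hA : IsSymmBernoulliMatrix P p A) {m : ℕ}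
    (hm : 2 ≤ m) (hn : 0 < n) (hp0 : 0 < (p : ℝ)) (hp : (p : ℝ) ≤ 1 / 2)
    (hθ : ((4 * m : ℕ) : ℝ) ^ 2 ≤ n * p) (d : ℕ) (hd : 4 * d ≤ 2 * m + 3) :
    ∫ ω, (normalizedTrace P p m A ω -
        ∑ e, 2 / (n * √(p * (1 - p))) * (symmEntry A e ω - p)) ^ 2 ∂P ≤
      2 / n + 3 * (((4 * m : ℕ) : ℝ) ^ 6 / (n * p) +
        n ^ 2 * (((4 * m : ℕ) : ℝ) ^ 2 / (n * p)) ^ d) := by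
  obtain ⟨k, hk⟩ : ∃ k, 2 * m = k + 1 := ⟨2 * m - 1, by omega⟩
  have h4m : 4 * m = 2 * (k + 1) := by omega
  have hq : (0 : ℝ) < 1 - p := by linarith
  have hnr : (0 : ℝ) < n := by exact_mod_cast hn
  rw [hA.integral_normalizedTrace_sub_sq_eq hk hn hp0 (by linarith), h4m,
    div_le_iff₀ (by positivity), mul_comm _ (((_ : ℝ) * _) ^ 2 * _)]
  exact hA.variance_sum_closedWalk_sub_le (by omega) hn hp0 hp (h4m ▸ hθ) d (hk ▸ hd)

end IsSymmBernoulliMatrix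

/-! ### Asymptotics in n -/

section Limits

variable {ε₀ : ℝ} {p : ℕ → unitInterval} {m : ℕ → ℕ}

lemma tendsto_scale {r : ℕ → ℝ}
    (hr : ∀ᶠ n : ℕ in atTop, 1 ≤ n * r n ∧ r n ≤ 1 / 2) :
    Tendsto (fun n : ℕ ↦ 2 / (n * √(r n * (1 - r n)))) atTop (𝓝 0) := by
  have hlim : Tendsto (fun n : ℕ ↦ √(8 / (n : ℝ))) atTop (𝓝 0) := by
    have h := (tendsto_const_div_atTop_nhds_zero_nat (8 : ℝ)).sqrt
    rwa [Real.sqrt_zero] at h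
  refine tendsto_of_tendsto_of_tendsto_of_le_of_le' tendsto_const_nhds hlim
    (Eventually.of_forall fun n ↦ by positivity) ?_
  filter_upwards [hr, eventually_gt_atTop 0] with n ⟨h1, h2⟩ hn
  have hnr : (0 : ℝ) < n := by exact_mod_cast hn
  have hr0 : 0 < r n := by
    by_contra h
    push Not at h
    nlinarith
  have hq : 1 / 2 ≤ 1 - r n := by linarith
  have hpq : 0 < r n * (1 - r n) := mul_pos hr0 (by linarith)
  refine Real.le_sqrt_of_sq_le ?_
  rw [div_pow, mul_pow, Real.sq_sqrt hpq.le, div_le_div_iff₀ (by positivity) hnr]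
  have h3 : 1 / 2 ≤ n * r n * (1 - r n) := by nlinarith
  nlinarith

/-- The linear statistic is asymptotically normal. -/
lemma tendsto_charFun_linear
    (hp : ∀ᶠ n : ℕ in atTop, 1 ≤ n * (p n : ℝ) ∧ (p n : ℝ) ≤ 1 / 2)
    (Ω : ℕ → Type*) [∀ n, MeasurableSpace (Ω n)] (P : ∀ n, Measure (Ω n))
    [∀ n, IsProbabilityMeasure (P n)] (A : ∀ n, Ω n → Matrix (Fin n) (Fin n) ℝ)
    (hA : ∀ n, IsSymmBernoulliMatrix (P n) (p n) (A n)) (t : ℝ) :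
    Tendsto (fun n ↦ charFun ((P n).map fun ω ↦ ∑ e, 2 / (n * √((p n : ℝ) * (1 - p n))) *
      (symmEntry (A n) e ω - p n)) t) atTop (𝓝 (Complex.exp ((-t ^ 2 : ℝ)))) := by
  set b : ℕ → ℝ := fun n ↦ t * (2 / (n * √((p n : ℝ) * (1 - p n)))) with hb
  have hb0 : Tendsto b atTop (𝓝 0) := by
    simpa using (tendsto_scale (r := fun n ↦ (p n : ℝ)) hp).const_mul t
  have hratio : Tendsto (fun n : ℕ ↦ 1 + 1 / (n : ℝ)) atTop (𝓝 1) := by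
    simpa using (tendsto_const_div_atTop_nhds_zero_nat (1 : ℝ)).const_add 1
  -- The exact variance of the linear statistic, times `t ^ 2`; half of it tends to `t ^ 2`, the
  -- exponent of N(0,2).
  have hvar : ∀ᶠ n : ℕ in atTop, (Fintype.card (Sym2 (Fin n)) : ℝ) *
      (b n ^ 2 * ((p n : ℝ) * (1 - p n))) = 2 * t ^ 2 * (1 + 1 / n) := by
    filter_upwards [hp, eventually_gt_atTop 0] with n ⟨h1, h2⟩ hn
    have hnr : (0 : ℝ) < n := by exact_mod_cast hn
    have hr0 : 0 < (p n : ℝ) := by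
      by_contra h
      push Not at h
      nlinarith
    have hpq : 0 < (p n : ℝ) * (1 - p n) := mul_pos hr0 (by linarith)
    rw [card_sym2_fin, hb]
    simp only
    rw [mul_pow, div_pow, mul_pow, Real.sq_sqrt hpq.le]
    have h3 : (1 - (p n : ℝ)) ≠ 0 := by intro h; rw [h, mul_zero] at hpq; exact lt_irrefl _ hpq
    field_simp
  have hmain : Tendsto (fun n : ℕ ↦ Complex.exp ((-((Fintype.card (Sym2 (Fin n)) : ℝ) *
      (b n ^ 2 * ((p n : ℝ) * (1 - p n))) / 2) : ℝ))) atTop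
      (𝓝 (Complex.exp ((-t ^ 2 : ℝ)))) := by
    have h1 : Tendsto (fun n : ℕ ↦ -(2 * t ^ 2 * (1 + 1 / (n : ℝ)) / 2)) atTop
        (𝓝 (-t ^ 2)) := by
      have := ((hratio.const_mul (2 * t ^ 2)).div_const 2).neg
      convert this using 2
      ring
    have h2 : Tendsto (fun n : ℕ ↦ Complex.exp ((-(2 * t ^ 2 * (1 + 1 / (n : ℝ)) / 2) : ℝ)))
        atTop (𝓝 (Complex.exp ((-t ^ 2 : ℝ)))) :=
      ((Complex.continuous_exp.comp Complex.continuous_ofReal).tendsto _).comp h1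
    refine h2.congr' ?_
    filter_upwards [hvar] with n hn
    rw [hn]
  have herr : Tendsto (fun n : ℕ ↦ (Fintype.card (Sym2 (Fin n)) : ℝ) *
      (b n ^ 2 * ((p n : ℝ) * (1 - p n)) *
        ((|b n| + b n ^ 2) * Real.exp (|b n| + b n ^ 2)))) atTop (𝓝 0) := by
    have h1 : Tendsto (fun n ↦ |b n| + b n ^ 2) atTop (𝓝 0) := by
      simpa using hb0.abs.add (hb0.pow 2)
    have h2 : Tendsto (fun n ↦ (|b n| + b n ^ 2) * Real.exp (|b n| + b n ^ 2)) atTop (𝓝 0) := by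
      simpa using h1.mul ((Real.continuous_exp.tendsto _).comp h1)
    have h3 := (hratio.const_mul (2 * t ^ 2)).mul h2
    rw [mul_zero] at h3
    refine h3.congr' ?_
    filter_upwards [hvar] with n hn
    rw [← hn]
    ring
  have hdiff := squeeze_zero_norm (fun n ↦ norm_charFun_sum_bernoulli_sub_le
    (hA n).hasLaw_symmEntry (hA n).iIndepFun_symmEntry (2 / (n * √((p n : ℝ) * (1 - p n)))) t) herr
  have hsum := hdiff.add hmain
  rw [zero_add] at hsum
  exact hsum.congr fun n ↦ sub_add_cancel _ _

/-- The size conditions on `p` and `m` used below, in a form free of logarithms of logarithms. -/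
lemma eventually_size_bounds (hε : 0 < ε₀) (hε1 : ε₀ < 1)
    (hp : ∀ᶠ n : ℕ in atTop, (n : ℝ) ^ (ε₀ - 1) ≤ (p n : ℝ) ∧ (p n : ℝ) ≤ 1 / 2)
    (hm : ∀ᶠ n : ℕ in atTop, 1 / (1 / 100 * ε₀) ≤ (m n : ℝ) ∧
      (m n : ℝ) ≤ 1 / 100 * ε₀ * Real.log n / Real.log (Real.log n)) :
    ∀ᶠ n : ℕ in atTop, (n : ℝ) ^ ε₀ ≤ n * (p n : ℝ) ∧ (p n : ℝ) ≤ 1 / 2 ∧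
      100 ≤ ε₀ * m n ∧ (m n : ℝ) ≤ Real.log n ∧
      16 * Real.log n ^ 2 ≤ (n : ℝ) ^ (ε₀ / 2) ∧ 1 < n := by
  have hlog : Tendsto (fun n : ℕ ↦ Real.log n) atTop atTop :=
    Real.tendsto_log_atTop.comp tendsto_natCast_atTop_atTop
  have hloglog : Tendsto (fun n : ℕ ↦ Real.log (Real.log n)) atTop atTop :=
    Real.tendsto_log_atTop.comp hlog
  have hlo := ((isLittleO_log_rpow_rpow_atTop (s := ε₀ / 2) 2 (by positivity)).comp_tendsto
    (tendsto_natCast_atTop_atTop (R := ℝ))).bound (c := 1 / 16) (by norm_num)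
  filter_upwards [hp, hm, hloglog.eventually_ge_atTop 1, hlog.eventually_ge_atTop 1, hlo,
    eventually_gt_atTop 1] with n ⟨hp1, hp2⟩ ⟨hm1, hm2⟩ hll hl hlo hn
  have hnr : (0 : ℝ) < n := by exact_mod_cast (by omega : 0 < n)
  refine ⟨?_, hp2, ?_, ?_, ?_, hn⟩
  · have h1 : (n : ℝ) ^ ε₀ = n * (n : ℝ) ^ (ε₀ - 1) := by
      rw [Real.rpow_sub_one hnr.ne']
      field_simp
    rw [h1]
    exact mul_le_mul_of_nonneg_left hp1 hnr.le
  · rw [div_le_iff₀ (by positivity)] at hm1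
    linarith
  · refine hm2.trans ?_
    rw [div_le_iff₀ (by linarith)]
    nlinarith
  · simp only [Function.comp_apply] at hlo
    rw [Real.norm_of_nonneg (by positivity), Real.norm_of_nonneg (by positivity)] at hlo
    rw [← Real.rpow_natCast]
    norm_num at hlo ⊢
    linarith

/-- The normalized trace and the linear statistic merge in `L²`. -/
lemma tendsto_integral_normalizedTrace_sub_sq (hε : 0 < ε₀) (hε1 : ε₀ < 1)
    (h : ∀ᶠ n : ℕ in atTop, (n : ℝ) ^ ε₀ ≤ n * (p n : ℝ) ∧ (p n : ℝ) ≤ 1 / 2 ∧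
      100 ≤ ε₀ * m n ∧ (m n : ℝ) ≤ Real.log n ∧
      16 * Real.log n ^ 2 ≤ (n : ℝ) ^ (ε₀ / 2) ∧ 1 < n)
    (Ω : ℕ → Type*) [∀ n, MeasurableSpace (Ω n)] (P : ∀ n, Measure (Ω n))
    [∀ n, IsProbabilityMeasure (P n)] (A : ∀ n, Ω n → Matrix (Fin n) (Fin n) ℝ)
    (hA : ∀ n, IsSymmBernoulliMatrix (P n) (p n) (A n)) :
    Tendsto (fun n : ℕ ↦ ∫ ω, (normalizedTrace (P n) (p n) (m n) (A n) ω -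
      ∑ e, 2 / (n * √((p n : ℝ) * (1 - p n))) * (symmEntry (A n) e ω - p n)) ^ 2 ∂(P n))
      atTop (𝓝 0) := by
  have hlim : Tendsto (fun n : ℕ ↦ 2 / (n : ℝ) + 3 * (4096 * (Real.log n ^ (6 : ℝ) / (n : ℝ) ^ ε₀)
      + 1 / n)) atTop (𝓝 0) := by
    have h1 := ((isLittleO_log_rpow_rpow_atTop (s := ε₀) 6 hε).comp_tendsto
      (tendsto_natCast_atTop_atTop (R := ℝ))).tendsto_div_nhds_zero
    have h2 := tendsto_const_div_atTop_nhds_zero_nat (2 : ℝ)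
    have h3 := tendsto_const_div_atTop_nhds_zero_nat (1 : ℝ)
    simpa using h2.add (((h1.const_mul 4096).add h3).const_mul 3)
  refine tendsto_of_tendsto_of_tendsto_of_le_of_le' tendsto_const_nhds hlim
    (Eventually.of_forall fun n ↦ integral_nonneg fun ω ↦ sq_nonneg _) ?_
  filter_upwards [h] with n ⟨h1, h2, h3, h4, h5, hn⟩
  have hnr : (0 : ℝ) < n := by exact_mod_cast (by omega : 0 < n)
  have hn1 : (1 : ℝ) ≤ n := by exact_mod_cast hn.le
  have hpow : (0 : ℝ) < (n : ℝ) ^ ε₀ := Real.rpow_pos_of_pos hnr _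
  have hnp : 0 < (n : ℝ) * p n := hpow.trans_le h1
  have hp0 : 0 < (p n : ℝ) := pos_of_mul_pos_right hnp hnr.le
  have hm0 : (0 : ℝ) ≤ m n := Nat.cast_nonneg _
  have hm100 : (100 : ℝ) ≤ m n := by nlinarith
  have hK2 : ((4 * m n : ℕ) : ℝ) ^ 2 ≤ (n : ℝ) ^ (ε₀ / 2) := by
    push_cast
    nlinarith
  have hhalf : (n : ℝ) ^ (ε₀ / 2) * (n : ℝ) ^ (ε₀ / 2) = (n : ℝ) ^ ε₀ := by
    rw [← Real.rpow_add hnr, add_halves]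
  have hhalf1 : 1 ≤ (n : ℝ) ^ (ε₀ / 2) := Real.one_le_rpow hn1 (by positivity)
  have hθ : ((4 * m n : ℕ) : ℝ) ^ 2 ≤ n * p n := by nlinarith
  have hx : ((4 * m n : ℕ) : ℝ) ^ 2 / (n * p n) ≤ (n : ℝ) ^ (-(ε₀ / 2)) := by
    rw [div_le_iff₀ hnp, Real.rpow_neg hnr.le]
    calc _ ≤ (n : ℝ) ^ (ε₀ / 2) := hK2
      _ = ((n : ℝ) ^ (ε₀ / 2))⁻¹ * (n : ℝ) ^ ε₀ := by
          rw [← hhalf]; field_simp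
      _ ≤ _ := by gcongr
  -- The largest `d` with `4 * d ≤ 2 * m + 3`; rounding up a quarter of the walk length ensures `m ≤
  -- 2 * d`.
  set d := (2 * m n + 3) / 4 with hd
  have hdm : (m n : ℝ) ≤ 2 * d := by exact_mod_cast (by omega : m n ≤ 2 * d)
  refine ((hA n).integral_normalizedTrace_sub_sq_le (m := m n)
    (by exact_mod_cast (by linarith : (2 : ℝ) ≤ m n)) (by omega) hp0 h2 hθ d (by omega)).trans ?_
  have hxd : (((4 * m n : ℕ) : ℝ) ^ 2 / (n * p n)) ^ d ≤ (n : ℝ) ^ (-3 : ℝ) := by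
    calc _ ≤ ((n : ℝ) ^ (-(ε₀ / 2))) ^ d := by gcongr
      _ = (n : ℝ) ^ (-(ε₀ / 2) * d) := by rw [← Real.rpow_natCast, ← Real.rpow_mul hnr.le]
      -- The exponent is ample: `ε₀ / 2 * d ≥ ε₀ * m / 4 ≥ 25`. Three powers of n suffice to beat
      -- the factor `n ^ 2`.
      _ ≤ _ := Real.rpow_le_rpow_of_exponent_le hn1 (by nlinarith)
  have hlast : (n : ℝ) ^ 2 * (((4 * m n : ℕ) : ℝ) ^ 2 / (n * p n)) ^ d ≤ 1 / n := by
    calc _ ≤ (n : ℝ) ^ 2 * (n : ℝ) ^ (-3 : ℝ) := by gcongr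
      _ = 1 / n := by
          rw [Real.rpow_neg hnr.le, show (3 : ℝ) = ((3 : ℕ) : ℝ) by norm_num, Real.rpow_natCast]
          field_simp
  have hmid : ((4 * m n : ℕ) : ℝ) ^ 6 / (n * p n) ≤
      4096 * (Real.log n ^ (6 : ℝ) / (n : ℝ) ^ ε₀) := by
    have h6 : ((4 * m n : ℕ) : ℝ) ^ 6 ≤ 4096 * Real.log n ^ (6 : ℝ) := by
      rw [show (6 : ℝ) = ((6 : ℕ) : ℝ) by norm_num, Real.rpow_natCast]
      push_cast
      rw [mul_pow]
      have := pow_le_pow_left₀ hm0 h4 6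
      norm_num
      linarith
    rw [← mul_div_assoc]
    exact div_le_div₀ (le_trans (by positivity) h6) h6 hpow h1
  linarith

end Limits

theorem theorem1 :
    ∃ c₀ : ℝ, 0 < c₀ ∧
      ∀ ε₀ : ℝ, 0 < ε₀ → ε₀ < 1 →
      ∀ p : ℕ → unitInterval,
      (∀ᶠ n : ℕ in atTop, (n : ℝ) ^ (ε₀ - 1) ≤ (p n : ℝ) ∧ (p n : ℝ) ≤ 1 / 2) →
      ∀ m : ℕ → ℕ,
      (∀ᶠ n : ℕ in atTop, 1 / (c₀ * ε₀) ≤ (m n : ℝ) ∧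
        (m n : ℝ) ≤ c₀ * ε₀ * Real.log n / Real.log (Real.log n)) →
      ∀ (Ω : ℕ → Type*) [∀ n, MeasurableSpace (Ω n)] (P : ∀ n, Measure (Ω n))
        [∀ n, IsProbabilityMeasure (P n)] (A : ∀ n, Ω n → Matrix (Fin n) (Fin n) ℝ),
      (∀ n, IsSymmBernoulliMatrix (P n) (p n) (A n)) →
      TendstoInDistribution (fun n ↦ normalizedTrace (P n) (p n : ℝ) (m n) (A n)) atTop
        (id : ℝ → ℝ) P (gaussianReal 0 2) := by
  -- The value 1/100 is not optimized. It gives `ε₀ * m ≥ 100`, and from the upper bound on `m` only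
  -- `m ≤ log n` is kept.
  refine ⟨1 / 100, by norm_num, fun ε₀ hε hε1 p hp m hm Ω _ P _ A hA ↦ ?_⟩
  have hsize := eventually_size_bounds hε hε1 hp hm
  have hX : ∀ n, MemLp (normalizedTrace (P n) (p n) (m n) (A n)) 2 (P n) := fun n ↦
    (hA n).memLp_normalizedTrace _ _
  refine ⟨fun n ↦ (hX n).aestronglyMeasurable.aemeasurable, by fun_prop, ?_⟩
  refine ProbabilityMeasure.tendsto_iff_tendsto_charFun.2 fun t ↦ ?_
  have hlim : charFun ((gaussianReal 0 2).map id) t = Complex.exp ((-t ^ 2 : ℝ)) := by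
    rw [Measure.map_id, charFun_gaussianReal]
    congr 1
    push_cast
    ring
  simp only [ProbabilityMeasure.coe_mk]
  rw [hlim]
  have hlin := tendsto_charFun_linear (hsize.mono fun n h ↦ ⟨le_trans
    (Real.one_le_rpow (by exact_mod_cast h.2.2.2.2.2.le) hε.le) h.1, h.2.1⟩) Ω P A hA t
  have hsq := ((tendsto_integral_normalizedTrace_sub_sq hε hε1 hsize Ω P A hA).sqrt).const_mul |t|
  rw [Real.sqrt_zero, mul_zero] at hsq
  have hdiff := squeeze_zero_norm (fun n ↦ norm_charFun_map_sub_le (hX n)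
    ((hA n).memLp_linear (2 / (n * √((p n : ℝ) * (1 - p n))))) t) hsq
  simpa using hdiff.add hlin
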